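/- Let \(u\) be a user with a finite set \(\mathcal N\) of followers and a finite set \(\mathcal C\) of topics. Follower \(v\) gives feedback to any story on topic \(c\) with probability \(q_{cv}\in[0,1]\), independently over all stories. In each round \(t=1,2,\dots\) the user posts a story on a topic \(c_t\) and observes the responses \(l_v(c_t)\in\{0,1\}\) of all her followers. In addition, in each round she observes, for every \(c\in\mathcal C\) and \(v\in\mathcal N\), the responses of \(v\) to a \(\mathrm{Poisson}(\mu_{cv})\)-distributed number of stories on topic \(c\) by others, where \(\mu_{cv}>0\) and these numbers are independent. Given weights \(a_v,a_u\ge 0\) with \(\sum_{v\in\mathcal N} a_v+a_u=1\) and own preferences \(x_c\in[0,1]\), the utility of a posting rule is \(\mathbb E\big[\sum_{t=1}^T\big(\sum_{v} a_v l_v(c_t)+a_u x_{c_t}\big)\big]\). Put \(\eta_c=\sum_v a_v q_{cv}+a_u x_c\); the optimal rule always posts a topic that maximizes \(\eta_c\). The algorithm with posterior samples, with prior parameters \(\alpha,\beta>0\), draws in each round, given the history, independent samples \(\hat q_{cv}(t)\sim\mathrm{Beta}(\alpha+n_{cv}(t),\beta+\bar n_{cv}(t))\), where \(n_{cv}(t)\)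 and \(\bar n_{cv}(t)\) are the numbers of positive and negative responses of \(v\) on topic \(c\) observed before round \(t\), and posts a topic \(c_t\) that maximizes \(\sum_v a_v\hat q_{cv}(t)+a_u x_c\); ties are broken by a predetermined rule. Its regret \(R(T)\) is the difference between the utilities over \(T\) rounds of the optimal rule and of the algorithm. Then there are \(d_m>0\) and \(K\), depending on \(\alpha,\beta\), the weights, the \(x_c\), the preferences \(q_{cv}\) and the tie-breaking rule, but not on the rates \(\mu_{cv}\) or on \(T\), such that with \(\theta_m=1-e^{-d_m}\) the following holds for all rates \(\mu_{cv}>0\). (1) For all \(T\ge 0\), \[ |R(T)|\le K\sum_{c:\ \eta_c<\max_{c'}\eta_{c'}}\left(1+\log\Big(1+\sum_{v\in\mathcal N}\frac{1-\exp(-\mu_{cv}\theta_m T)}{\mu_{cv}\theta_m}\Big)\right). \] (2) For every topic \(c\), \[ R(T)=O\left(\log\Big(1+\sum_{v\in\mathcal N}\frac{1-\exp(-\mu_{cv}\theta_m T)}{\mu_{cv}\theta_m}\Big)\right) \] as a bound for all \(T\ge 0\), with a constant that may also depend on the rates. (3) For fixed rates, \(R(T)\) is bounded in \(T\). -/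

import Mathlib

open MeasureTheory ProbabilityTheory
open scoped NNReal unitInterval

namespace Posting

/-- A user with topic set `C` and follower set `V`: the parameters of the feedback model, of the
utility and of the algorithm. -/
structure Setting (C V : Type*) [Fintype V] where
  /-- first parameter of the Beta prior -/
  α : ℝ
  /-- second parameter of the Beta prior -/
  β : ℝ
  α_pos : 0 < α
  β_pos : 0 < β
  /-- the weight `a_v` of follower `v` -/
  a : V → ℝ
  /-- the weight `a_u` of the user's own preferences -/
  aU : ℝ
  a_nonneg : ∀ v, 0 ≤ a v
  aU_nonneg : 0 ≤ aU
  sum_weights : ∑ v, a v + aU = 1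
  /-- the user's own preference for each topic -/
  x : C → ℝ
  x_mem : ∀ c, x c ∈ Set.Icc (0 : ℝ) 1
  /-- the true preference `q c v` of follower `v` for topic `c` -/
  q : C → V → I
  /-- the predetermined rule that breaks ties between topics -/
  tieBreak : Finset C → C
  tieBreak_mem : ∀ s : Finset C, s.Nonempty → tieBreak s ∈ s

/-- The elementary randomness, as a triple `ω = (Y, M, B)`:
* `Y (c, v, i)`: whether follower `v` gives feedback to the `i`-th story on topic `c` that she is
  shown (by the user or by anybody else);
* `M (t, c, v)`: the number of stories of others on topic `c` that are shown to `v` in round `t`;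
* `B (t, c, v, n, m)`: the draw made in round `t` for the pair `(c, v)` if the history contains
  `n` positive and `m` negative responses of `v` on topic `c`. -/
abbrev Sample (C V : Type*) :=
  (C × V × ℕ → Bool) × (ℕ × C × V → ℕ) × (ℕ × C × V × ℕ × ℕ → ℝ)

section Run

variable {C V : Type*}

/-- Number of positive responses of `v` on topic `c` among the first `N c v` stories shown. -/
def positives (ω : Sample C V) (N : C → V → ℕ) (c : C) (v : V) : ℕ :=
  ((Finset.range (N c v)).filter fun i => ω.1 (c, v, i) = true).card

/-- Number of negative responses of `v` on topic `c` among the first `N c v` stories shown. -/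
def negatives (ω : Sample C V) (N : C → V → ℕ) (c : C) (v : V) : ℕ :=
  ((Finset.range (N c v)).filter fun i => ω.1 (c, v, i) = false).card

/-- A posting rule: it sees the numbers of positive and of negative responses in the history, and
the draws `b (c, v, n, m)` of the current round, and chooses a topic. -/
abbrev Rule (C V : Type*) :=
  (C → V → ℕ) → (C → V → ℕ) → (C × V × ℕ × ℕ → ℝ) → C

/-- The topic that the rule chooses in round `t` if, for each topic `c` and follower `v`, the
history contains the responses of `v` to the first `N c v` stories on topic `c`. -/
def choice (r : Rule C V) (ω : Sample C V) (t : ℕ) (N : C → V → ℕ) : C :=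
  r (positives ω N) (negatives ω N) fun p => ω.2.2 (t, p)

open Classical in
/-- `seen r ω t c v` is the number of stories on topic `c`, by the user (who follows the rule `r`)
or by others, whose response by `v` is in the history at the beginning of round `t`. Rounds are
numbered `0, 1, 2, …` and the initial history is empty. -/
noncomputable def seen (r : Rule C V) (ω : Sample C V) : ℕ → C → V → ℕ
  | 0 => fun _ _ => 0
  | t + 1 => fun c v =>
      seen r ω t c v + (if choice r ω t (seen r ω t) = c then 1 else 0) + ω.2.1 (t, c, v)

/-- The topic `c_t` of the story that the user shares in round `t`. -/
noncomputable def topic (r : Rule C V) (ω : Sample C V) (t : ℕ) : C :=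
  choice r ω t (seen r ω t)

/-- The response `l_v(c_t)` of `v` to the user's story of round `t`, which is the next story on its
topic that `v` is shown (the stories of others in round `t` follow it). -/
noncomputable def response (r : Rule C V) (ω : Sample C V) (t : ℕ) (v : V) : Bool :=
  ω.1 (topic r ω t, v, seen r ω t (topic r ω t) v)

end Run

namespace Setting

variable {C V : Type*} [Fintype C] [Fintype V] (S : Setting C V)

/-- The law of the elementary randomness, all coordinates being independent: `v` gives feedback to
a story on topic `c` with probability `q c v`, the numbers of stories of others per round are
Poisson with rate `μ c v`, and the draws have the posterior laws `Beta (α + n, β + m)`. -/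
noncomputable def law (μ : C → V → ℝ≥0) : Measure (Sample C V) :=
  (Measure.infinitePi fun p : C × V × ℕ => bernoulliMeasure true false (S.q p.1 p.2.1)).prod
    ((Measure.infinitePi fun p : ℕ × C × V => poissonMeasure (μ p.2.1 p.2.2)).prod
      (Measure.infinitePi fun p : ℕ × C × V × ℕ × ℕ =>
        betaMeasure (S.α + (p.2.2.2.1 : ℝ)) (S.β + (p.2.2.2.2 : ℝ))))

/-- The score `∑ v, a_v p_{c v} + a_u x_c` of topic `c` under the preferences `p`. -/
noncomputable def score (p : C → V → ℝ) (c : C) : ℝ :=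
  ∑ v, S.a v * p c v + S.aU * S.x c

open Classical in
/-- The topic of maximal score under the preferences `p`. -/
noncomputable def argmax (p : C → V → ℝ) : C :=
  S.tieBreak (Finset.univ.filter fun c => ∀ c', S.score p c' ≤ S.score p c)

/-- The true preferences, as real numbers. -/
def trueQ (c : C) (v : V) : ℝ := (S.q c v : ℝ)

/-- The algorithm with posterior samples: the estimate for `(c, v)` is drawn from
`Beta (α + n, β + m)`, with `n` and `m` the numbers of positive and of negative responses of `v` on
topic `c` so far, and the topic that maximizes the estimated score is posted. -/
noncomputable def thompson : Rule C V := fun n m b =>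
  S.argmax fun c v => b (c, v, n c v, m c v)

/-- The optimal rule, which knows the true preferences. -/
noncomputable def optimal : Rule C V := fun _ _ _ => S.argmax S.trueQ

/-- The utility of a posting rule over `T` rounds:
`𝔼 [∑_t (∑_v a_v l_v(c_t) + a_u x_{c_t})]`. -/
noncomputable def utility (μ : C → V → ℝ≥0) (r : Rule C V) (T : ℕ) : ℝ :=
  ∫ ω, ∑ t ∈ Finset.range T,
    (∑ v, S.a v * (if response r ω t v = true then 1 else 0) + S.aU * S.x (topic r ω t)) ∂(S.law μ)

/-- The regret over `T` rounds of the algorithm with posterior samples. -/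
noncomputable def regret (μ : C → V → ℝ≥0) (T : ℕ) : ℝ :=
  S.utility μ S.optimal T - S.utility μ S.thompson T

open Classical in
/-- The topics whose score under the true preferences is not maximal. -/
noncomputable def suboptimal : Finset C :=
  Finset.univ.filter fun c => ∃ c', S.score S.trueQ c < S.score S.trueQ c'

end Setting

/-- The rate `log (1 + ∑ v, (1 - exp (- μ_{c v} θ T)) / (μ_{c v} θ))` of topic `c`. -/
noncomputable def rate {C V : Type*} [Fintype V] (μ : C → V → ℝ≥0) (θ : ℝ) (c : C) (T : ℕ) : ℝ :=
  Real.log (1 + ∑ v, (1 - Real.exp (-((μ c v : ℝ) * θ * (T : ℝ)))) / ((μ c v : ℝ) * θ))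

end Posting

/-! A story posted on topic `c` has mean utility `η_c`, since its response is a fresh coin that the
choice of `c` did not use. Hence the regret is at most the sum, over suboptimal `c`, of the expected
number of posts on `c`. Let `c₀` be the optimal topic and `ε` a margin with `η_c + ε < η_{c₀} - ε`.
The rounds that post `c` are of three kinds.

(a) Fewer than `L` earlier posts on `c`: at most `L` rounds.

(b) At least `L` earlier posts, but some draw for `c` exceeds `q + ε`. After `n` responses the
posterior probability of this has mean at most `K ρ^n` with `ρ < 1`. The actual `n` depends on the
responses through past choices, so one sums over all `n` from `L` plus the number of stories of
others, which is independent of the responses. By the Poisson generating function, round `t`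
contributes at most a multiple of `ρ^L ∑_v exp(-μ_{cv} θ t)` with `θ = 1 - ρ`.

(c) All draws for `c` are at most `q + ε`, so all scores are below `η_{c₀} - ε`. Given the history
and the draws for the other topics, low draws for `c₀` are at most `1/p - 1` times as likely as
uniformly high ones, which would make `c₀` win; `p` is the probability that all draws for `c₀`
exceed `q - ε`. So such rounds are charged to posts on `c₀`, and the odds decay geometrically in
mean with their number: the total is bounded.

The decay in (b) and (c) is one estimate (`lintegral_setLIntegral_likelihood_div_le`): posterior
ratios are ratios of integrated likelihoods, Cauchy-Schwarz moves the denominator inside, and the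
mean likelihood ratio of two fixed preferences is an exact `n`-th power.

If `A` is the sum inside the logarithm, the total is `L + O(ρ^L (1 + A)) + O(1)`. Taking `L` near
`log (1 + A) / d` with `ρ = exp (-d)` gives (1). As `A` is bounded in `T`, (3) follows, and (2)
follows from (3). -/

namespace Posting

open scoped ENNReal

/-! ### Resampling and independence in infinite product measures -/

section ProductMeasure

variable {ι : Type*} {X : ι → Type*} [∀ i, MeasurableSpace (X i)]

open Classical in
theorem measurable_piecewise_prod (A : Set ι) :
    Measurable fun p : (∀ i, X i) × (∀ i, X i) => A.piecewise p.2 p.1 := by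
  refine measurable_pi_lambda _ fun i => ?_
  by_cases hi : i ∈ A
  · simp only [Set.piecewise, hi, if_true]; fun_prop
  · simp only [Set.piecewise, hi, if_false]; fun_prop

open Classical in
/-- Replacing the coordinates in `A` by those of an independent copy preserves a product measure. -/
theorem measurePreserving_piecewise (μ : ∀ i, Measure (X i)) [∀ i, IsProbabilityMeasure (μ i)]
    (A : Set ι) :
    MeasurePreserving (fun p : (∀ i, X i) × (∀ i, X i) => A.piecewise p.2 p.1)
      ((Measure.infinitePi μ).prod (Measure.infinitePi μ)) (Measure.infinitePi μ) := by
  refine ⟨measurable_piecewise_prod A, ?_⟩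
  refine Measure.eq_infinitePi μ fun s t ht => ?_
  rw [Measure.map_apply (measurable_piecewise_prod A)
    (MeasurableSet.pi s.countable_toSet fun i _ => ht i)]
  have : (fun p : (∀ i, X i) × (∀ i, X i) => A.piecewise p.2 p.1) ⁻¹' (Set.pi s t) =
      (Set.pi (s.filter (· ∉ A)) t) ×ˢ (Set.pi (s.filter (· ∈ A)) t) := by
    ext ⟨x, y⟩
    simp only [Set.mem_preimage, Set.mem_pi, Set.mem_prod, Finset.mem_coe, Finset.mem_filter]
    constructor
    · intro h
      exact ⟨fun i hi => by simpa [Set.piecewise, hi.2] using h i hi.1,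
        fun i hi => by simpa [Set.piecewise, hi.2] using h i hi.1⟩
    · rintro ⟨h1, h2⟩ i hi
      by_cases hA : i ∈ A
      · simpa [Set.piecewise, hA] using h2 i ⟨hi, hA⟩
      · simpa [Set.piecewise, hA] using h1 i ⟨hi, hA⟩
  rw [this, Measure.prod_prod, Measure.infinitePi_pi _ fun i _ => ht i,
    Measure.infinitePi_pi _ fun i _ => ht i, mul_comm]
  exact Finset.prod_filter_mul_prod_filter_not s (· ∈ A) _

-- Integrates out the coordinates in `A` with the others frozen; this replaces conditioning on the
-- history throughout.
open Classical in
theorem lintegral_infinitePi_resample (μ : ∀ i, Measure (X i)) [∀ i, IsProbabilityMeasure (μ i)]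
    (A : Set ι) {f : (∀ i, X i) → ℝ≥0∞} (hf : Measurable f) :
    ∫⁻ x, f x ∂Measure.infinitePi μ =
      ∫⁻ x, ∫⁻ y, f (A.piecewise y x) ∂Measure.infinitePi μ ∂Measure.infinitePi μ := by
  rw [← (measurePreserving_piecewise μ A).lintegral_comp hf,
    lintegral_prod (fun p => f (A.piecewise p.2 p.1))
      (hf.comp (measurable_piecewise_prod A)).aemeasurable]

/-- After resampling `t`, the factor `f` sees only the old point and `g` only the new one. -/
theorem lintegral_infinitePi_mul (μ : ∀ i, Measure (X i)) [∀ i, IsProbabilityMeasure (μ i)]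
    {f g : (∀ i, X i) → ℝ≥0∞} (hf : Measurable f) (hg : Measurable g) {s t : Set ι}
    (hfs : DependsOn f s) (hgt : DependsOn g t) (hst : Disjoint s t) :
    ∫⁻ x, f x * g x ∂Measure.infinitePi μ =
      (∫⁻ x, f x ∂Measure.infinitePi μ) * ∫⁻ x, g x ∂Measure.infinitePi μ := by
  classical
  rw [lintegral_infinitePi_resample μ t (f := fun x => f x * g x) (hf.mul hg)]
  have h1 : ∀ x y, f (t.piecewise y x) = f x := fun x y =>
    hfs fun i hi => by simp [Set.piecewise, Set.disjoint_left.1 hst hi]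
  have h2 : ∀ x y, g (t.piecewise y x) = g y := fun x y =>
    hgt fun i hi => by simp [Set.piecewise, hi]
  simp_rw [h1, h2, lintegral_const_mul _ hg]
  rw [lintegral_mul_const _ hf]

theorem lintegral_infinitePi_finset_prod (μ : ∀ i, Measure (X i)) [∀ i, IsProbabilityMeasure (μ i)]
    {κ : Type*} (J : Finset κ) {f : κ → (∀ i, X i) → ℝ≥0∞} (hf : ∀ k, Measurable (f k))
    {s : κ → Set ι} (hfs : ∀ k, DependsOn (f k) (s k)) (hs : Pairwise (Function.onFun Disjoint s)) :
    ∫⁻ x, ∏ k ∈ J, f k x ∂Measure.infinitePi μ = ∏ k ∈ J, ∫⁻ x, f k x ∂Measure.infinitePi μ := by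
  classical
  induction J using Finset.induction_on with
  | empty => simp
  | insert k J hk ih =>
    simp_rw [Finset.prod_insert hk]
    rw [lintegral_infinitePi_mul μ (hf k) (Finset.measurable_prod _ fun k _ => hf k) (hfs k)
      (t := ⋃ j ∈ J, s j), ih]
    · intro x y hxy
      refine Finset.prod_congr rfl fun j hj => hfs j fun i hi => hxy i ?_
      simp only [Set.mem_iUnion]
      exact ⟨j, hj, hi⟩
    · rw [Set.disjoint_iUnion₂_right]
      intro j hj
      exact hs (by rintro rfl; exact hk hj)

theorem lintegral_infinitePi_prod_eval (μ : ∀ i, Measure (X i)) [∀ i, IsProbabilityMeasure (μ i)]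
    {κ : Type*} (J : Finset κ) (e : κ → ι) (he : Function.Injective e)
    {f : ∀ k, X (e k) → ℝ≥0∞} (hf : ∀ k, Measurable (f k)) :
    ∫⁻ x, ∏ k ∈ J, f k (x (e k)) ∂Measure.infinitePi μ = ∏ k ∈ J, ∫⁻ x, f k x ∂μ (e k) := by
  rw [lintegral_infinitePi_finset_prod μ J (f := fun k x => f k (x (e k))) (s := fun k => {e k})]
  · exact Finset.prod_congr rfl fun k _ =>
      (measurePreserving_eval_infinitePi μ (e k)).lintegral_comp (hf k)
  · intro k; have := hf k; fun_prop
  · intro k x y hxy; simp only; rw [hxy _ rfl]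
  · intro i j hij; simpa [Function.onFun] using fun h => hij (he h)

end ProductMeasure

/-! ### Bernoulli and Poisson integrals -/

theorem lintegral_bernoulliMeasure (p : I) (f : Bool → ℝ≥0∞) :
    ∫⁻ b, f b ∂(bernoulliMeasure true false p) =
      ENNReal.ofReal p * f true + ENNReal.ofReal (1 - p) * f false := by
  rw [bernoulliMeasure_def, lintegral_add_measure, lintegral_smul_measure, lintegral_smul_measure,
    lintegral_dirac, lintegral_dirac]
  have h (r : I) : ENNReal.ofReal r = (unitInterval.toNNReal r : ℝ≥0∞) := by
    rw [ENNReal.ofReal]; congr 1; ext; simp [r.2.1]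
  rw [show (1 - p : ℝ) = (unitInterval.symm p : ℝ) from rfl, h, h]
  rfl

theorem lintegral_pow_poissonMeasure (r : ℝ≥0) {ρ : ℝ} (hρ : 0 ≤ ρ) :
    ∫⁻ n, ENNReal.ofReal ρ ^ n ∂(poissonMeasure r) = ENNReal.ofReal (Real.exp (-(r * (1 - ρ)))) := by
  rw [poissonMeasure, lintegral_sum_measure]
  simp only [lintegral_smul_measure, lintegral_dirac, smul_eq_mul]
  have : ∀ n : ℕ, ENNReal.ofReal (Real.exp (-r) * r ^ n / (n.factorial)) * ENNReal.ofReal ρ ^ n =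
      ENNReal.ofReal (Real.exp (-r) * ((r * ρ) ^ n / n.factorial)) := by
    intro n
    rw [← ENNReal.ofReal_pow hρ, ← ENNReal.ofReal_mul (by positivity)]
    congr 1; rw [mul_pow]; ring
  simp_rw [this]
  have hs := (NormedSpace.expSeries_div_hasSum_exp ((r : ℝ) * ρ)).mul_left (Real.exp (-r))
  rw [← ENNReal.ofReal_tsum_of_nonneg (fun n => by positivity) hs.summable, hs.tsum_eq,
    ← Real.exp_eq_exp_ℝ, ← Real.exp_add]
  congr 2; ring

/-! ### Beta posteriors and their likelihoods -/

section Beta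

/-- The likelihood of `s` positive and `m` negative responses under the preference `x`. -/
noncomputable def likelihood (s m : ℕ) (x : ℝ) : ℝ≥0∞ :=
  ENNReal.ofReal x ^ s * ENNReal.ofReal (1 - x) ^ m

@[fun_prop]
theorem measurable_likelihood (s m : ℕ) : Measurable (likelihood s m) := by
  unfold likelihood; fun_prop

theorem likelihood_ne_top (s m : ℕ) (x : ℝ) : likelihood s m x ≠ ∞ :=
  ENNReal.mul_ne_top (ENNReal.pow_ne_top ENNReal.ofReal_ne_top)
    (ENNReal.pow_ne_top ENNReal.ofReal_ne_top)

theorem likelihood_ne_zero (s m : ℕ) {x : ℝ} (h0 : 0 < x) (h1 : x < 1) : likelihood s m x ≠ 0 := by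
  refine mul_ne_zero (pow_ne_zero _ ?_) (pow_ne_zero _ ?_) <;> simp [h0, h1]

@[fun_prop]
theorem measurable_betaPDF (α β : ℝ) : Measurable (betaPDF α β) :=
  (measurable_betaPDFReal α β).ennreal_ofReal

variable {α β : ℝ}

/-- Conjugacy: the posterior is the prior reweighted by the likelihood. -/
theorem betaPDF_mul_likelihood (hα : 0 < α) (hβ : 0 < β) (s m : ℕ) (x : ℝ) :
    betaPDF α β x * likelihood s m x =
      ENNReal.ofReal (beta (α + s) (β + m) / beta α β) * betaPDF (α + s) (β + m) x := by
  rcases le_or_gt x 0 with hx | hx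
  · simp [betaPDF_eq_zero_of_nonpos hx]
  rcases le_or_gt 1 x with hx1 | hx1
  · simp [betaPDF_eq_zero_of_one_le hx1]
  have h1 : 0 < 1 - x := by linarith
  have hb := beta_pos hα hβ
  have hb' : 0 < beta (α + s) (β + m) := beta_pos (by positivity) (by positivity)
  rw [betaPDF_of_pos_lt_one hx hx1, betaPDF_of_pos_lt_one hx hx1, likelihood,
    ← ENNReal.ofReal_pow hx.le, ← ENNReal.ofReal_pow h1.le, ← ENNReal.ofReal_mul (by positivity),
    ← ENNReal.ofReal_mul (by positivity), ← ENNReal.ofReal_mul (by positivity)]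
  congr 1
  rw [show α + s - 1 = (α - 1) + s by ring, show β + m - 1 = (β - 1) + m by ring,
    Real.rpow_add_natCast hx.ne', Real.rpow_add_natCast h1.ne']
  field_simp

theorem setLIntegral_likelihood (hα : 0 < α) (hβ : 0 < β) (s m : ℕ) {A : Set ℝ}
    (hA : MeasurableSet A) :
    ∫⁻ x in A, likelihood s m x ∂betaMeasure α β =
      ENNReal.ofReal (beta (α + s) (β + m) / beta α β) * betaMeasure (α + s) (β + m) A := by
  rw [betaMeasure, setLIntegral_withDensity_eq_setLIntegral_mul _ (by fun_prop) (by fun_prop) hA,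
    betaMeasure, withDensity_apply _ hA, ← lintegral_const_mul _ (by fun_prop)]
  exact lintegral_congr fun x => betaPDF_mul_likelihood hα hβ s m x

theorem betaMeasure_Icc_ne_zero (hα : 0 < α) (hβ : 0 < β) {y z : ℝ} (hy : 0 < y) (hyz : y < z)
    (hz : z < 1) : betaMeasure α β (Set.Icc y z) ≠ 0 := by
  rw [betaMeasure, withDensity_apply _ measurableSet_Icc]
  refine (setLIntegral_pos_iff (by fun_prop)).2 ?_ |>.ne'
  have : Function.support (betaPDF α β) ∩ Set.Icc y z = Set.Icc y z := by
    refine Set.inter_eq_right.2 fun x hx => ?_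
    have := betaPDFReal_pos (hy.trans_le hx.1) (hx.2.trans_lt hz) hα hβ
    simpa [betaPDF] using this
  rw [this]; simpa using hyz

theorem betaMeasure_eq_zero_of_disjoint {A : Set ℝ} (hA : MeasurableSet A)
    (h : Disjoint A (Set.Ioo 0 1)) : betaMeasure α β A = 0 := by
  rw [betaMeasure, withDensity_apply _ hA]
  refine setLIntegral_eq_zero hA fun x hx => ?_
  have := Set.disjoint_left.1 h hx
  rcases le_or_gt x 0 with hx | hx
  · exact betaPDF_eq_zero_of_nonpos hx
  · exact betaPDF_eq_zero_of_one_le (not_lt.1 fun h1 => this ⟨hx, h1⟩)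

theorem ae_betaMeasure_mem_Ioo : ∀ᵐ x ∂betaMeasure α β, x ∈ Set.Ioo (0 : ℝ) 1 :=
  betaMeasure_eq_zero_of_disjoint measurableSet_Ioo.compl disjoint_compl_left

/-- The normalising constant cancels, so the data enter through the likelihood alone. Shrinking `B`
to `J` allows a compact interval inside `(0, 1)`, where the likelihood can be inverted. -/
theorem betaMeasure_div_le (hα : 0 < α) (hβ : 0 < β) (s m : ℕ) {A B J : Set ℝ}
    (hA : MeasurableSet A) (hJ : MeasurableSet J) (hJB : J ⊆ B) :
    betaMeasure (α + s) (β + m) A / betaMeasure (α + s) (β + m) B ≤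
      (∫⁻ x in A, likelihood s m x ∂betaMeasure α β) /
        ∫⁻ x in J, likelihood s m x ∂betaMeasure α β := by
  rw [setLIntegral_likelihood hα hβ s m hA, setLIntegral_likelihood hα hβ s m hJ]
  have h0 : 0 < beta (α + s) (β + m) / beta α β :=
    div_pos (beta_pos (by positivity) (by positivity)) (beta_pos hα hβ)
  rw [ENNReal.mul_div_mul_left _ _ (by simpa using h0) ENNReal.ofReal_ne_top]
  gcongr

/-- The Cauchy-Schwarz bound for the reciprocal of an integral. -/
theorem inv_lintegral_le {X : Type*} [MeasurableSpace X] (ν : Measure X) [IsFiniteMeasure ν]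
    (hν : ν Set.univ ≠ 0) {g : X → ℝ≥0∞} (hg : Measurable g) (h0 : ∀ᵐ x ∂ν, g x ≠ 0)
    (ht : ∀ x, g x ≠ ∞) :
    (∫⁻ x, g x ∂ν)⁻¹ ≤ ((ν Set.univ) ^ 2)⁻¹ * ∫⁻ x, (g x)⁻¹ ∂ν := by
  -- Applied to `g^(1/2)` and `g^(-1/2)`, whose product is 1 almost everywhere.
  have h := ENNReal.lintegral_mul_le_Lp_mul_Lq ν (p := 2) (q := 2)
    (by rw [Real.holderConjugate_iff]; norm_num)
    (f := fun x => g x ^ (1 / 2 : ℝ)) (g := fun x => (g x)⁻¹ ^ (1 / 2 : ℝ))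
    (by fun_prop) (by fun_prop)
  have e1 : ∫⁻ x, ((fun x => g x ^ (1 / 2 : ℝ)) * (fun x => (g x)⁻¹ ^ (1 / 2 : ℝ))) x ∂ν
      = ν Set.univ := by
    rw [← lintegral_one]
    refine lintegral_congr_ae ?_
    filter_upwards [h0] with x hx
    simp only [Pi.mul_apply]
    rw [← ENNReal.mul_rpow_of_nonneg _ _ (by norm_num), ENNReal.mul_inv_cancel hx (ht x),
      ENNReal.one_rpow]
  rw [e1] at h
  simp only [← ENNReal.rpow_mul] at h
  norm_num at h
  have h2 : (ν Set.univ) ^ 2 ≤ (∫⁻ x, g x ∂ν) * ∫⁻ x, (g x)⁻¹ ∂ν := by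
    refine (pow_le_pow_left₀ zero_le h 2).trans (le_of_eq ?_)
    rw [← ENNReal.mul_rpow_of_nonneg _ _ (by norm_num), ← ENNReal.rpow_natCast,
      ← ENNReal.rpow_mul]
    norm_num
  have hn : (ν Set.univ) ^ 2 ≠ 0 := pow_ne_zero _ hν
  have ht2 : (ν Set.univ) ^ 2 ≠ ∞ := ENNReal.pow_ne_top (measure_ne_top _ _)
  rw [← one_div]
  refine ENNReal.div_le_of_le_mul ?_
  rw [mul_assoc, mul_comm (∫⁻ x, (g x)⁻¹ ∂ν), ← ENNReal.inv_mul_cancel hn ht2]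
  gcongr

end Beta

/-! ### Response counts and expected likelihood ratios -/

section Hits

variable {C V : Type*}

/-- The number of responses `b` of `v` on topic `c` among the first `n` stories shown. -/
def hits (y : C × V × ℕ → Bool) (c : C) (v : V) (n : ℕ) (b : Bool) : ℕ :=
  ((Finset.range n).filter fun i => y (c, v, i) = b).card

theorem hits_dependsOn (c : C) (v : V) (n : ℕ) (b : Bool) :
    DependsOn (fun y : C × V × ℕ → Bool => hits y c v n b) {p | p.1 = c ∧ p.2.1 = v ∧ p.2.2 < n} := by
  intro y y' h
  simp only [hits]
  congr 1
  refine Finset.filter_congr fun i hi => ?_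
  rw [h (c, v, i) ⟨rfl, rfl, Finset.mem_range.1 hi⟩]

@[fun_prop]
theorem measurable_hits (c : C) (v : V) (n : ℕ) (b : Bool) :
    Measurable fun y : C × V × ℕ → Bool => hits y c v n b := by
  simp only [hits, Finset.card_filter]
  refine Finset.measurable_sum _ fun i _ => ?_
  exact Measurable.ite (measurableSet_eq_fun (by fun_prop) (by fun_prop)) (by fun_prop)
    (by fun_prop)

theorem measurable_hits_comp (f : ℕ → ℕ → ℝ≥0∞) (c : C) (v : V) (n : ℕ) :
    Measurable fun y : C × V × ℕ → Bool => f (hits y c v n true) (hits y c v n false) :=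
  (measurable_of_countable (Function.uncurry f)).comp
    ((measurable_hits c v n true).prodMk (measurable_hits c v n false))

theorem likelihood_hits (y : C × V × ℕ → Bool) (c : C) (v : V) (n : ℕ) (x : ℝ) :
    likelihood (hits y c v n true) (hits y c v n false) x =
      ∏ i ∈ Finset.range n,
        if y (c, v, i) = true then ENNReal.ofReal x else ENNReal.ofReal (1 - x) := by
  rw [Finset.prod_ite, Finset.prod_const, Finset.prod_const]
  simp only [Bool.not_eq_true]
  rfl

/-- The stories are independent, and each contributes the factor `q x / z + (1 - q) (1 - x) / (1 -
z)`, which is the base of the power. It is below 1 exactly when `z` lies strictly between `x` and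
`q`. -/
theorem lintegral_likelihood_div (q : C → V → I) (c : C) (v : V) (n : ℕ) {x z : ℝ}
    (hx : x ∈ Set.Ioo (0 : ℝ) 1) (hz : z ∈ Set.Ioo (0 : ℝ) 1) :
    ∫⁻ y, likelihood (hits y c v n true) (hits y c v n false) x *
        (likelihood (hits y c v n true) (hits y c v n false) z)⁻¹
        ∂(Measure.infinitePi fun p : C × V × ℕ => bernoulliMeasure true false (q p.1 p.2.1)) =
      ENNReal.ofReal (1 + (x - z) * (q c v - z) / (z * (1 - z))) ^ n := by
  obtain ⟨hx0, hx1⟩ := hx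
  obtain ⟨hz0, hz1⟩ := hz
  have hx1' : 0 < 1 - x := by linarith
  have hz1' : 0 < 1 - z := by linarith
  have hq0 := (q c v).2.1
  have hq1 : 0 ≤ 1 - (q c v : ℝ) := by linarith [(q c v).2.2]
  have h : ∀ y : C × V × ℕ → Bool, likelihood (hits y c v n true) (hits y c v n false) x *
        (likelihood (hits y c v n true) (hits y c v n false) z)⁻¹ = ∏ i ∈ Finset.range n,
        (fun b : Bool => if b = true then ENNReal.ofReal (x / z)
          else ENNReal.ofReal ((1 - x) / (1 - z))) (y (c, v, i)) := by
    intro y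
    rw [likelihood_hits, likelihood_hits, ENNReal.prod_inv_distrib, ← Finset.prod_mul_distrib]
    · refine Finset.prod_congr rfl fun i _ => ?_
      dsimp only
      split_ifs
      · rw [ENNReal.ofReal_div_of_pos hz0, div_eq_mul_inv]
      · rw [ENNReal.ofReal_div_of_pos hz1', div_eq_mul_inv]
    · intro i _ j _ _
      left
      split_ifs <;> simp [hz0, hz1]
  rw [lintegral_congr h, lintegral_infinitePi_prod_eval
    (fun p : C × V × ℕ => bernoulliMeasure true false (q p.1 p.2.1)) (Finset.range n)
    (fun i => (c, v, i)) (fun i j hij => by simpa using hij)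
    (f := fun _ b => if b = true then ENNReal.ofReal (x / z)
      else ENNReal.ofReal ((1 - x) / (1 - z))) (fun _ => measurable_of_countable _)]
  simp only [lintegral_bernoulliMeasure, Finset.prod_const, Finset.card_range, if_true,
    Bool.false_eq_true, if_false]
  congr 1
  rw [← ENNReal.ofReal_mul hq0, ← ENNReal.ofReal_mul hq1, ← ENNReal.ofReal_add (by positivity)
    (by positivity)]
  congr 1
  field_simp
  ring

/-- If, against the truth `q c v`, the preferences in `J` beat those in `A` uniformly, then the
expected ratio of the likelihoods of `A` and `J` decays geometrically. -/
theorem lintegral_setLIntegral_likelihood_div_le {α β : ℝ} (hα : 0 < α) (hβ : 0 < β)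
    (q : C → V → I) (c : C) (v : V)
    {A : Set ℝ} (hA : MeasurableSet A) {y z : ℝ} (hy : 0 < y) (hyz : y < z) (hz : z < 1) {δ : ℝ}
    (hδ : ∀ x ∈ A, ∀ w ∈ Set.Icc y z, (x - w) * (q c v - w) ≤ -δ) (hδ0 : 0 ≤ δ) (n : ℕ) :
    ∫⁻ Y, (∫⁻ x in A, likelihood (hits Y c v n true) (hits Y c v n false) x ∂betaMeasure α β) /
        (∫⁻ x in Set.Icc y z, likelihood (hits Y c v n true) (hits Y c v n false) x
          ∂betaMeasure α β)
        ∂(Measure.infinitePi fun p : C × V × ℕ => bernoulliMeasure true false (q p.1 p.2.1)) ≤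
      ((betaMeasure α β (Set.Icc y z)) ^ 2)⁻¹ * ENNReal.ofReal (1 - 4 * δ) ^ n := by
  have := isProbabilityMeasureBeta hα hβ
  set P := Measure.infinitePi fun p : C × V × ℕ => bernoulliMeasure true false (q p.1 p.2.1)
  set π := betaMeasure α β
  have hJ : π (Set.Icc y z) ≠ 0 := betaMeasure_Icc_ne_zero hα hβ hy hyz hz
  have hmem : ∀ w ∈ Set.Icc y z, w ∈ Set.Ioo (0 : ℝ) 1 := fun w hw =>
    ⟨hy.trans_le hw.1, hw.2.trans_lt hz⟩
  let g : (C × V × ℕ → Bool) → ℝ → ℝ≥0∞ := fun Y =>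
    likelihood (hits Y c v n true) (hits Y c v n false)
  have hg : Measurable fun p : (C × V × ℕ → Bool) × ℝ => g p.1 p.2 := by
    simp only [g, likelihood]
    fun_prop
  have hgY : ∀ Y, Measurable (g Y) := fun Y => measurable_likelihood _ _
  -- With the reciprocal integral turned into an integral of reciprocals, Tonelli reduces the mean
  -- over `Y` to that of a likelihood ratio for each pair `(x, w)`.
  have step1 : ∀ Y, (∫⁻ x in A, g Y x ∂π) / (∫⁻ x in Set.Icc y z, g Y x ∂π) ≤
      ((π (Set.Icc y z)) ^ 2)⁻¹ *
        ∫⁻ x in A, ∫⁻ w in Set.Icc y z, g Y x * (g Y w)⁻¹ ∂π ∂π := by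
    intro Y
    have h := inv_lintegral_le (π.restrict (Set.Icc y z)) (by simpa using hJ) (hgY Y)
      ((ae_restrict_mem measurableSet_Icc).mono fun w hw =>
        likelihood_ne_zero _ _ (hmem w hw).1 (hmem w hw).2)
      (fun w => likelihood_ne_top _ _ w)
    rw [Measure.restrict_apply_univ] at h
    rw [div_eq_mul_inv]
    have h' : ∀ x, ∫⁻ w in Set.Icc y z, g Y x * (g Y w)⁻¹ ∂π =
        g Y x * ∫⁻ w in Set.Icc y z, (g Y w)⁻¹ ∂π := fun x =>
      lintegral_const_mul _ (hgY Y).inv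
    simp_rw [h']
    rw [lintegral_mul_const _ (hgY Y), mul_left_comm]
    gcongr
  refine (lintegral_mono step1).trans ?_
  have hm : Measurable fun p : ((C × V × ℕ → Bool) × ℝ) × ℝ => g p.1.1 p.1.2 * (g p.1.1 p.2)⁻¹ :=
    (hg.comp (by fun_prop : Measurable fun p : ((C × V × ℕ → Bool) × ℝ) × ℝ =>
      (p.1.1, p.1.2))).mul (hg.comp (by fun_prop : Measurable fun p :
        ((C × V × ℕ → Bool) × ℝ) × ℝ => (p.1.1, p.2))).inv
  have hm2 : Measurable fun p : (C × V × ℕ → Bool) × ℝ =>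
      ∫⁻ w in Set.Icc y z, g p.1 p.2 * (g p.1 w)⁻¹ ∂π := hm.lintegral_prod_right'
  rw [lintegral_const_mul _ hm2.lintegral_prod_right']
  gcongr
  rw [lintegral_lintegral_swap hm2.aemeasurable]
  have step2 : ∀ᵐ x ∂π.restrict A, ∫⁻ Y, ∫⁻ w in Set.Icc y z, g Y x * (g Y w)⁻¹ ∂π ∂P ≤
      ENNReal.ofReal (1 - 4 * δ) ^ n := by
    filter_upwards [ae_restrict_of_ae (ae_betaMeasure_mem_Ioo (α := α) (β := β)),
      ae_restrict_mem hA] with x hx hxA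
    rw [lintegral_lintegral_swap (f := fun Y w => g Y x * (g Y w)⁻¹) (hm.comp (by fun_prop : Measurable fun p :
      (C × V × ℕ → Bool) × ℝ => ((p.1, x), p.2))).aemeasurable]
    refine (setLIntegral_mono' measurableSet_Icc (g := fun _ => ENNReal.ofReal (1 - 4 * δ) ^ n)
      fun w hw => ?_).trans ?_
    · rw [lintegral_likelihood_div q c v n hx (hmem w hw)]
      gcongr
      have hw0 := (hmem w hw).1
      have hw1 : 0 < 1 - w := by linarith [(hmem w hw).2]
      -- Source of the factor 4 in the decay rate.
      have h4 : w * (1 - w) ≤ 1 / 4 := by nlinarith [sq_nonneg (w - 1 / 2)]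
      have : (x - w) * (q c v - w) / (w * (1 - w)) ≤ -(4 * δ) := by
        rw [div_le_iff₀ (by positivity)]
        have := hδ x hxA w hw
        nlinarith
      linarith
    · rw [lintegral_const, Measure.restrict_apply_univ]
      exact mul_le_of_le_one_right zero_le prob_le_one
  refine (lintegral_mono_ae step2).trans ?_
  rw [lintegral_const, Measure.restrict_apply_univ]
  exact mul_le_of_le_one_right zero_le prob_le_one

end Hits

/-! ### Concentration of the posterior -/

namespace Setting

variable {C V : Type*} [Fintype V] (S : Setting C V)

/-- The law of the responses. -/
noncomputable def feedbackLaw : Measure (C × V × ℕ → Bool) :=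
  Measure.infinitePi fun p : C × V × ℕ => bernoulliMeasure true false (S.q p.1 p.2.1)

instance : IsProbabilityMeasure S.feedbackLaw := by unfold feedbackLaw; infer_instance

/-- The posterior law of the preference of `v` for topic `c` after `n` responses. -/
noncomputable def posterior (y : C × V × ℕ → Bool) (c : C) (v : V) (n : ℕ) : Measure ℝ :=
  betaMeasure (S.α + (hits y c v n true : ℝ)) (S.β + (hits y c v n false : ℝ))

theorem isProbabilityMeasure_beta (n m : ℕ) :
    IsProbabilityMeasure (betaMeasure (S.α + (n : ℝ)) (S.β + (m : ℝ))) :=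
  isProbabilityMeasureBeta (add_pos_of_pos_of_nonneg S.α_pos n.cast_nonneg)
    (add_pos_of_pos_of_nonneg S.β_pos m.cast_nonneg)

instance (y : C × V × ℕ → Bool) (c : C) (v : V) (n : ℕ) :
    IsProbabilityMeasure (S.posterior y c v n) :=
  S.isProbabilityMeasure_beta _ _

/-- The posterior probability to overestimate the preference of `v` for topic `c` by `ε`. -/
noncomputable def overProb (ε : ℝ) (y : C × V × ℕ → Bool) (c : C) (v : V) (n : ℕ) : ℝ≥0∞ :=
  S.posterior y c v n (Set.Ioi (S.q c v + ε))

/-- The posterior odds to underestimate the preference of `v` for topic `c` by `ε`. -/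
noncomputable def underOdds (ε : ℝ) (y : C × V × ℕ → Bool) (c : C) (v : V) (n : ℕ) : ℝ≥0∞ :=
  S.posterior y c v n (Set.Iic (S.q c v - ε)) / S.posterior y c v n (Set.Ioi (S.q c v - ε))

@[fun_prop]
theorem measurable_overProb (ε : ℝ) (c : C) (v : V) (n : ℕ) :
    Measurable fun y => S.overProb ε y c v n :=
  measurable_hits_comp (fun s m => betaMeasure (S.α + (s : ℝ)) (S.β + (m : ℝ))
    (Set.Ioi (S.q c v + ε))) c v n

@[fun_prop]
theorem measurable_underOdds (ε : ℝ) (c : C) (v : V) (n : ℕ) :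
    Measurable fun y => S.underOdds ε y c v n :=
  measurable_hits_comp (fun s m =>
    betaMeasure (S.α + (s : ℝ)) (S.β + (m : ℝ)) (Set.Iic (S.q c v - ε)) /
    betaMeasure (S.α + (s : ℝ)) (S.β + (m : ℝ)) (Set.Ioi (S.q c v - ε))) c v n

theorem underOdds_dependsOn (ε : ℝ) (c : C) (v : V) (n : ℕ) :
    DependsOn (fun y => S.underOdds ε y c v n) {p | p.2.1 = v} := by
  intro y y' h
  have := fun b => hits_dependsOn c v n b (x := y) (y := y') fun p hp => h p hp.2.1
  simp only at this
  simp only [underOdds, posterior, this]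

theorem posterior_Ioi_ne_zero {ε : ℝ} (hε : 0 < ε) (y : C × V × ℕ → Bool) (c : C) (v : V) (n : ℕ) :
    S.posterior y c v n (Set.Ioi (S.q c v - ε)) ≠ 0 := by
  have hq := (S.q c v).2.2
  have h1 : max 0 (S.q c v - ε) < 1 := by simp; linarith
  obtain ⟨a, ha, ha1⟩ := exists_between h1
  obtain ⟨b, hb, hb1⟩ := exists_between ha1
  have h := betaMeasure_Icc_ne_zero (α := S.α + (hits y c v n true : ℝ))
    (β := S.β + (hits y c v n false : ℝ)) (add_pos_of_pos_of_nonneg S.α_pos (Nat.cast_nonneg _))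
    (add_pos_of_pos_of_nonneg S.β_pos (Nat.cast_nonneg _)) ((le_max_left _ _).trans_lt ha) hb hb1
  refine fun h0 => h (measure_mono_null (fun x hx => ?_) h0)
  exact ((le_max_right _ _).trans_lt ha).trans_le hx.1

/-- Products of these terms over the followers are thus reciprocals of the probability that all
draws are high. -/
theorem one_add_underOdds {ε : ℝ} (hε : 0 < ε) (y : C × V × ℕ → Bool) (c : C) (v : V) (n : ℕ) :
    1 + S.underOdds ε y c v n = (S.posterior y c v n (Set.Ioi (S.q c v - ε)))⁻¹ := by
  have h0 := S.posterior_Ioi_ne_zero hε y c v n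
  rw [underOdds, ← ENNReal.div_self h0 (measure_ne_top _ _), ← ENNReal.add_div, ← Set.compl_Iic,
    add_comm, measure_add_measure_compl measurableSet_Iic, measure_univ, one_div]

theorem exists_lintegral_overProb_le {ε : ℝ} (hε : 0 < ε) (c : C) (v : V) :
    ∃ K : ℝ≥0∞, K ≠ ∞ ∧ ∀ n, ∫⁻ y, S.overProb ε y c v n ∂S.feedbackLaw ≤
      K * ENNReal.ofReal (1 - 4 * (ε ^ 2 / 9)) ^ n := by
  have hq0 := (S.q c v).2.1
  rcases le_or_gt 1 (S.q c v + ε) with h1 | h1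
  · refine ⟨0, by simp, fun n => ?_⟩
    have : ∀ y, S.overProb ε y c v n = 0 := fun y =>
      betaMeasure_eq_zero_of_disjoint measurableSet_Ioi
        (Set.disjoint_left.2 fun x hx hx' => by have := hx'.2; simp at hx; linarith)
    simp [this]
  -- The comparison interval is the middle third between the truth and `q + ε`: its points are at
  -- least `ε / 3` away from both, whence `δ = ε ^ 2 / 9`. It lies in `(0, 1)` even when `q = 0`.
  have hJ := betaMeasure_Icc_ne_zero S.α_pos S.β_pos (y := S.q c v + ε / 3)
    (z := S.q c v + 2 * ε / 3) (by positivity) (by linarith) (by linarith)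
  refine ⟨((betaMeasure S.α S.β (Set.Icc (S.q c v + ε / 3) (S.q c v + 2 * ε / 3))) ^ 2)⁻¹,
    by simpa using hJ, fun n => ?_⟩
  refine (lintegral_mono fun y => ?_).trans (lintegral_setLIntegral_likelihood_div_le S.α_pos
    S.β_pos S.q c v (A := Set.Ioi (S.q c v + ε)) measurableSet_Ioi
    (y := S.q c v + ε / 3) (z := S.q c v + 2 * ε / 3)
    (by positivity) (by linarith) (by linarith) ?_ (by positivity) n)
  · refine le_trans (le_of_eq ?_) (betaMeasure_div_le S.α_pos S.β_pos _ _ measurableSet_Ioi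
      measurableSet_Icc (Set.subset_univ _))
    have := measure_univ (μ := S.posterior y c v n)
    rw [posterior] at this
    rw [this, div_one]
    rfl
  · intro x hx w hw
    have hx : (S.q c v : ℝ) + ε < x := hx
    nlinarith [hw.1, hw.2]

theorem exists_lintegral_underOdds_le {ε : ℝ} (hε : 0 < ε) (c : C) (v : V) :
    ∃ K : ℝ≥0∞, K ≠ ∞ ∧ ∀ n, ∫⁻ y, S.underOdds ε y c v n ∂S.feedbackLaw ≤
      K * ENNReal.ofReal (1 - 4 * (ε ^ 2 / 9)) ^ n := by
  have hq1 := (S.q c v).2.2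
  rcases le_or_gt (S.q c v - ε) 0 with h1 | h1
  · refine ⟨0, by simp, fun n => ?_⟩
    have : ∀ y, S.posterior y c v n (Set.Iic (S.q c v - ε)) = 0 := fun y =>
      betaMeasure_eq_zero_of_disjoint measurableSet_Iic
        (Set.disjoint_left.2 fun x hx hx' => by have := hx'.1; simp at hx; linarith)
    simp [underOdds, this]
  have hJ := betaMeasure_Icc_ne_zero S.α_pos S.β_pos (y := S.q c v - 2 * ε / 3)
    (z := S.q c v - ε / 3) (by linarith) (by linarith) (by linarith)
  refine ⟨((betaMeasure S.α S.β (Set.Icc (S.q c v - 2 * ε / 3) (S.q c v - ε / 3))) ^ 2)⁻¹,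
    by simpa using hJ, fun n => ?_⟩
  refine (lintegral_mono fun y => ?_).trans (lintegral_setLIntegral_likelihood_div_le S.α_pos
    S.β_pos S.q c v (A := Set.Iic (S.q c v - ε)) measurableSet_Iic
    (y := S.q c v - 2 * ε / 3) (z := S.q c v - ε / 3)
    (by linarith) (by linarith) (by linarith) ?_ (by positivity) n)
  · exact betaMeasure_div_le S.α_pos S.β_pos _ _ measurableSet_Iic
      measurableSet_Icc fun x hx => lt_of_lt_of_le (by linarith) hx.1
  · intro x hx w hw
    have hx : x ≤ (S.q c v : ℝ) - ε := hx
    nlinarith [hw.1, hw.2]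

theorem exists_lintegral_le [Fintype C] {ε : ℝ} (hε : 0 < ε) :
    ∃ K : ℝ≥0, ∀ c v n,
      ∫⁻ y, S.overProb ε y c v n ∂S.feedbackLaw ≤ K * ENNReal.ofReal (1 - 4 * (ε ^ 2 / 9)) ^ n ∧
      ∫⁻ y, S.underOdds ε y c v n ∂S.feedbackLaw ≤
        K * ENNReal.ofReal (1 - 4 * (ε ^ 2 / 9)) ^ n := by
  choose K1 hK1 h1 using S.exists_lintegral_overProb_le hε
  choose K2 hK2 h2 using S.exists_lintegral_underOdds_le hε
  have hfin : ∑ c, ∑ v, (K1 c v + K2 c v) ≠ ∞ :=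
    ENNReal.sum_ne_top.2 fun c _ => ENNReal.sum_ne_top.2 fun v _ =>
      ENNReal.add_ne_top.2 ⟨hK1 c v, hK2 c v⟩
  lift ∑ c, ∑ v, (K1 c v + K2 c v) to ℝ≥0 using hfin with K hK
  have hle : ∀ c v, K1 c v + K2 c v ≤ K := fun c v => hK ▸
    (Finset.single_le_sum (f := fun v => K1 c v + K2 c v) (fun _ _ => zero_le)
      (Finset.mem_univ v)).trans (Finset.single_le_sum (f := fun c => ∑ v, (K1 c v + K2 c v))
        (fun _ _ => zero_le) (Finset.mem_univ c))
  refine ⟨K, fun c v n => ⟨(h1 c v n).trans ?_, (h2 c v n).trans ?_⟩⟩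
  · gcongr; exact le_self_add.trans (hle c v)
  · gcongr; exact le_add_self.trans (hle c v)

end Setting

/-! ### What the history depends on -/

section Dynamics

variable {C V : Type*} (r : Rule C V)

theorem choice_congr {ω ω' : Sample C V} {N : C → V → ℕ} {t : ℕ}
    (hY : ∀ c v i, i < N c v → ω.1 (c, v, i) = ω'.1 (c, v, i))
    (hB : ∀ p, ω.2.2 (t, p) = ω'.2.2 (t, p)) : choice r ω t N = choice r ω' t N := by
  have h1 : positives ω N = positives ω' N := by
    funext c v
    exact congrArg Finset.card (Finset.filter_congr fun i hi => by
      rw [hY c v i (Finset.mem_range.1 hi)])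
  have h2 : negatives ω N = negatives ω' N := by
    funext c v
    exact congrArg Finset.card (Finset.filter_congr fun i hi => by
      rw [hY c v i (Finset.mem_range.1 hi)])
  simp only [choice, h1, h2, hB]

open Classical in
theorem seen_succ (ω : Sample C V) (t : ℕ) (c : C) (v : V) :
    seen r ω (t + 1) c v =
      seen r ω t c v + (if topic r ω t = c then 1 else 0) + ω.2.1 (t, c, v) := rfl

theorem seen_le_succ (ω : Sample C V) (t : ℕ) (c : C) (v : V) :
    seen r ω t c v ≤ seen r ω (t + 1) c v := by
  simp only [seen]; omega

/-- The history before round `t` does not depend on the draws of round `t` or later. -/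
theorem seen_congr_draws {ω ω' : Sample C V} {t : ℕ} (hY : ω.1 = ω'.1) (hM : ω.2.1 = ω'.2.1)
    (hB : ∀ s < t, ∀ p, ω.2.2 (s, p) = ω'.2.2 (s, p)) : seen r ω t = seen r ω' t := by
  induction t with
  | zero => rfl
  | succ t ih =>
    have h := ih fun s hs => hB s (by omega)
    have hc : topic r ω t = topic r ω' t := by
      rw [topic, topic, h]
      exact choice_congr r (fun c v i _ => by rw [hY]) (hB t (by omega))
    funext c v
    rw [seen_succ, seen_succ, hc, hM, h]

/-- The history before round `t` does not depend on responses that are not in it. -/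
theorem seen_congr_response {ω ω' : Sample C V} {t : ℕ} {c : C} {v : V} {i : ℕ}
    (hY : ∀ p, p ≠ (c, v, i) → ω.1 p = ω'.1 p) (hω : ω.2 = ω'.2) (hi : seen r ω t c v ≤ i) :
    seen r ω t = seen r ω' t ∧ topic r ω t = topic r ω' t := by
  have key : ∀ t, seen r ω t c v ≤ i → seen r ω t = seen r ω' t →
      topic r ω t = topic r ω' t := by
    intro t hi h
    rw [topic, topic, ← h]
    refine choice_congr r (fun c' v' j hj => hY _ ?_) (by simp [hω])
    rintro h
    simp only [Prod.mk.injEq] at h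
    obtain ⟨rfl, rfl, rfl⟩ := h
    omega
  have hseen : seen r ω t = seen r ω' t := by
    induction t with
    | zero => rfl
    | succ t ih =>
      have hi' := (seen_le_succ r ω t c v).trans hi
      have h := ih hi'
      have hc : topic r ω t = topic r ω' t := key t hi' h
      funext c v
      rw [seen_succ, seen_succ, hc, hω, h]
  exact ⟨hseen, key t hi hseen⟩

end Dynamics

/-! ### Measurability of the run -/

section Measurability

/-- Handles random indices, such as the position of the next story, by splitting over their
countably many values. -/
theorem measurableSet_setOf_comp {Ω D : Type*} [MeasurableSpace Ω] [MeasurableSpace D] [Countable D]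
    [MeasurableSingletonClass D] {f : Ω → D} (hf : Measurable f) {P : D → Ω → Prop}
    (hP : ∀ d, MeasurableSet {ω | P d ω}) : MeasurableSet {ω | P (f ω) ω} := by
  have : {ω | P (f ω) ω} = ⋃ d, f ⁻¹' {d} ∩ {ω | P d ω} := by
    ext ω; simp
  rw [this]
  exact MeasurableSet.iUnion fun d => (hf (measurableSet_singleton d)).inter (hP d)

variable {C V : Type*} {r : Rule C V}

/-- A rule whose choice is a measurable function of the draws. -/
def MeasurableRule (r : Rule C V) : Prop := ∀ n m c, MeasurableSet {b | r n m b = c}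

theorem measurable_positives (N : C → V → ℕ) :
    Measurable fun ω : Sample C V => positives ω N :=
  measurable_pi_lambda _ fun c => measurable_pi_lambda _ fun v =>
    (measurable_hits c v (N c v) true).comp measurable_fst

theorem measurable_negatives (N : C → V → ℕ) :
    Measurable fun ω : Sample C V => negatives ω N :=
  measurable_pi_lambda _ fun c => measurable_pi_lambda _ fun v =>
    (measurable_hits c v (N c v) false).comp measurable_fst

variable [Finite C] [Finite V]

theorem measurableSet_choice (hr : MeasurableRule r) (t : ℕ) (N : C → V → ℕ) (c : C) :
    MeasurableSet {ω : Sample C V | choice r ω t N = c} := by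
  refine measurableSet_setOf_comp (measurable_positives N)
    (P := fun n ω => r n (negatives ω N) (fun p => ω.2.2 (t, p)) = c) fun n => ?_
  refine measurableSet_setOf_comp (measurable_negatives N)
    (P := fun m ω => r n m (fun p => ω.2.2 (t, p)) = c) fun m => ?_
  exact (by fun_prop : Measurable fun (ω : Sample C V) p => ω.2.2 (t, p)) (hr n m c)

theorem measurable_seen (hr : MeasurableRule r) (t : ℕ) :
    Measurable fun ω : Sample C V => seen r ω t := by
  classical
  induction t with
  | zero => exact measurable_const
  | succ t ih =>
    refine measurable_pi_lambda _ fun c => measurable_pi_lambda _ fun v => ?_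
    simp only [seen]
    have h1 : Measurable fun ω : Sample C V => seen r ω t c v :=
      ((measurable_pi_apply (X := fun _ : V => ℕ) v).comp
      (measurable_pi_apply (X := fun _ : C => V → ℕ) c)).comp ih
    have h2 : MeasurableSet {ω : Sample C V | choice r ω t (seen r ω t) = c} :=
      measurableSet_setOf_comp ih fun N => measurableSet_choice hr t N c
    exact (h1.add (Measurable.ite h2 measurable_const measurable_const)).add (by fun_prop)

theorem measurable_seen_apply (hr : MeasurableRule r) (t : ℕ) (c : C) (v : V) :
    Measurable fun ω : Sample C V => seen r ω t c v :=
  ((measurable_pi_apply (X := fun _ : V => ℕ) v).comp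
      (measurable_pi_apply (X := fun _ : C => V → ℕ) c)).comp (measurable_seen hr t)

theorem measurableSet_topic (hr : MeasurableRule r) (t : ℕ) (c : C) :
    MeasurableSet {ω : Sample C V | topic r ω t = c} :=
  measurableSet_setOf_comp (measurable_seen hr t) fun N => measurableSet_choice hr t N c

end Measurability

/-! ### The law, its resampling identities, and the argmax -/

namespace Setting

variable {C V : Type*} [Fintype V] (S : Setting C V)

/-- The law of the numbers of stories of others. -/
noncomputable def storyLaw (μ : C → V → ℝ≥0) : Measure (ℕ × C × V → ℕ) :=
  Measure.infinitePi fun p : ℕ × C × V => poissonMeasure (μ p.2.1 p.2.2)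

/-- The law of the draws. -/
noncomputable def drawLaw : Measure (ℕ × C × V × ℕ × ℕ → ℝ) :=
  Measure.infinitePi fun p : ℕ × C × V × ℕ × ℕ =>
    betaMeasure (S.α + (p.2.2.2.1 : ℝ)) (S.β + (p.2.2.2.2 : ℝ))

instance (μ : C → V → ℝ≥0) : IsProbabilityMeasure (storyLaw μ) := by
  unfold storyLaw; infer_instance

instance (p : ℕ × C × V × ℕ × ℕ) :
    IsProbabilityMeasure (betaMeasure (S.α + (p.2.2.2.1 : ℝ)) (S.β + (p.2.2.2.2 : ℝ))) :=
  S.isProbabilityMeasure_beta _ _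

instance : IsProbabilityMeasure S.drawLaw := by unfold drawLaw; infer_instance

theorem law_eq (μ : C → V → ℝ≥0) :
    S.law μ = S.feedbackLaw.prod ((storyLaw μ).prod S.drawLaw) := rfl

instance (μ : C → V → ℝ≥0) : IsProbabilityMeasure (S.law μ) := by
  rw [law_eq]; infer_instance

open Classical in
theorem lintegral_law_resample_draws (μ : C → V → ℝ≥0) (A : Set (ℕ × C × V × ℕ × ℕ))
    {f : Sample C V → ℝ≥0∞} (hf : Measurable f) :
    ∫⁻ ω, f ω ∂S.law μ =
      ∫⁻ ω, ∫⁻ b, f (ω.1, ω.2.1, A.piecewise b ω.2.2) ∂S.drawLaw ∂S.law μ := by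
  have hm : Measurable fun p : Sample C V × (ℕ × C × V × ℕ × ℕ → ℝ) =>
      f (p.1.1, p.1.2.1, A.piecewise p.2 p.1.2.2) := by
    refine hf.comp (by
      refine Measurable.prodMk (by fun_prop) (Measurable.prodMk (by fun_prop) ?_)
      exact (measurable_piecewise_prod A).comp (by fun_prop :
        Measurable fun p : Sample C V × (ℕ × C × V × ℕ × ℕ → ℝ) => (p.1.2.2, p.2)))
  rw [law_eq, lintegral_prod _ hf.aemeasurable, lintegral_prod _ hm.lintegral_prod_right'.aemeasurable]
  refine lintegral_congr fun y => ?_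
  have hm2 : Measurable fun p : (ℕ × C × V → ℕ) × (ℕ × C × V × ℕ × ℕ → ℝ) =>
      ∫⁻ b, f (y, p.1, A.piecewise b p.2) ∂S.drawLaw :=
    hm.lintegral_prod_right'.comp (measurable_prodMk_left (x := y))
  rw [lintegral_prod _ (by fun_prop), lintegral_prod _ hm2.aemeasurable]
  refine lintegral_congr fun m => ?_
  exact lintegral_infinitePi_resample _ A (f := fun b => f (y, m, b)) (by fun_prop)

open Classical in
theorem lintegral_law_resample_feedback (μ : C → V → ℝ≥0) (A : Set (C × V × ℕ))
    {f : Sample C V → ℝ≥0∞} (hf : Measurable f) :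
    ∫⁻ ω, f ω ∂S.law μ =
      ∫⁻ ω, ∫⁻ y, f (A.piecewise y ω.1, ω.2) ∂S.feedbackLaw ∂S.law μ := by
  have hm : Measurable fun p : Sample C V × (C × V × ℕ → Bool) =>
      f (A.piecewise p.2 p.1.1, p.1.2) := by
    refine hf.comp (by
      refine Measurable.prodMk ?_ (by fun_prop)
      exact (measurable_piecewise_prod A).comp (by fun_prop :
        Measurable fun p : Sample C V × (C × V × ℕ → Bool) => (p.1.1, p.2)))
  rw [law_eq, lintegral_prod_symm _ hf.aemeasurable,
    lintegral_prod_symm _ hm.lintegral_prod_right'.aemeasurable]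
  refine lintegral_congr fun m => ?_
  exact lintegral_infinitePi_resample _ A (f := fun y => f (y, m)) (by fun_prop)

@[fun_prop]
theorem measurable_score {Ω : Type*} [MeasurableSpace Ω] {p : Ω → C → V → ℝ}
    (hp : ∀ c v, Measurable fun ω => p ω c v) (c : C) : Measurable fun ω => S.score (p ω) c := by
  unfold score; fun_prop

variable [Fintype C]

open Classical in
theorem argmax_mem (p : C → V → ℝ) (c : C) : S.score p c ≤ S.score p (S.argmax p) := by
  have : Nonempty C := ⟨S.tieBreak ∅⟩
  obtain ⟨c₀, h₀⟩ := Finite.exists_max (S.score p)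
  have := S.tieBreak_mem (Finset.univ.filter fun c => ∀ c', S.score p c' ≤ S.score p c)
    ⟨c₀, by simpa using h₀⟩
  exact (Finset.mem_filter.1 this).2 c

open Classical in
theorem measurableSet_argmax {Ω : Type*} [MeasurableSpace Ω] {p : Ω → C → V → ℝ}
    (hp : ∀ c v, Measurable fun ω => p ω c v) (c : C) :
    MeasurableSet {ω | S.argmax (p ω) = c} := by
  unfold argmax
  -- The tie-breaking rule is arbitrary, but it sees only the finite set of maximizers, so one
  -- splits over the value `s` of that set.
  have : {ω | S.tieBreak (Finset.univ.filter fun c => ∀ c', S.score (p ω) c' ≤ S.score (p ω) c) = c} =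
      ⋃ s ∈ {s | S.tieBreak s = c}, ⋂ c₁, {ω | (∀ c', S.score (p ω) c' ≤ S.score (p ω) c₁) ↔ c₁ ∈ s} := by
    ext ω
    simp only [Set.mem_ofPred_eq, Set.mem_iUnion, Set.mem_iInter, exists_prop]
    constructor
    · intro h
      exact ⟨_, h, fun c₁ => by simp⟩
    · rintro ⟨s, hs, h⟩
      rw [← hs]
      congr 1
      ext c₁
      simp [h c₁]
  have h2 : MeasurableSet (⋃ s ∈ {s | S.tieBreak s = c}, ⋂ c₁,
      {ω | (∀ c', S.score (p ω) c' ≤ S.score (p ω) c₁) ↔ c₁ ∈ s}) := by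
    refine MeasurableSet.biUnion (Set.to_countable _) fun s _ => MeasurableSet.iInter fun c₁ => ?_
    have h3 : MeasurableSet {ω | ∀ c', S.score (p ω) c' ≤ S.score (p ω) c₁} := by
      rw [Set.ofPred_forall]
      exact MeasurableSet.iInter fun c' =>
        measurableSet_le (S.measurable_score hp c') (S.measurable_score hp c₁)
    by_cases h : c₁ ∈ s
    · simpa [h] using h3
    · simp only [h, iff_false]
      exact h3.compl
  rwa [← this] at h2

theorem measurableRule_thompson : MeasurableRule S.thompson := fun n m c =>
  S.measurableSet_argmax (p := fun (b : C × V × ℕ × ℕ → ℝ) c v => b (c, v, n c v, m c v))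
    (fun c v => by fun_prop) c

theorem measurableRule_optimal : MeasurableRule S.optimal := fun n m c => by
  simp only [optimal]; exact MeasurableSet.const _

end Setting

/-! ### Regret as a sum of posting probabilities -/

namespace Setting

variable {C V : Type*} [Fintype V] (S : Setting C V) (μ : C → V → ℝ≥0) {r : Rule C V}

theorem score_nonneg (c : C) : 0 ≤ S.score S.trueQ c :=
  add_nonneg (Finset.sum_nonneg fun v _ => mul_nonneg (S.a_nonneg v) (S.q c v).2.1)
    (mul_nonneg S.aU_nonneg (S.x_mem c).1)

theorem score_le_one (c : C) : S.score S.trueQ c ≤ 1 := by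
  rw [← S.sum_weights]
  exact add_le_add (Finset.sum_le_sum fun v _ =>
    mul_le_of_le_one_right (S.a_nonneg v) (S.q c v).2.2)
    (mul_le_of_le_one_right S.aU_nonneg (S.x_mem c).2)

variable [Fintype C]

omit [Fintype C] [Fintype V] in
theorem indicator_one_eq_mul {X Y Z : Type*} {G : Set X} {E : Set Y} {F : Set Z} {x : X} {y : Y}
    {z : Z} (h : x ∈ G ↔ y ∈ E ∧ z ∈ F) :
    G.indicator (1 : X → ℝ≥0∞) x = E.indicator 1 y * F.indicator 1 z := by
  classical
  simp only [Set.indicator_apply, h, Pi.one_apply]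
  split_ifs <;> simp_all

theorem measurableSet_topic_response (hr : MeasurableRule r) (t : ℕ) (c : C) (v : V) :
    MeasurableSet {ω : Sample C V | topic r ω t = c ∧ response r ω t v = true} := by
  have h : {ω : Sample C V | topic r ω t = c ∧ response r ω t v = true} =
      {ω | topic r ω t = c} ∩ {ω | ω.1 (c, v, seen r ω t c v) = true} := by
    ext ω
    simp only [Set.mem_ofPred_eq, Set.mem_inter_iff, response]
    exact and_congr_right fun h => by rw [h]
  rw [h]
  refine (measurableSet_topic hr t c).inter ?_
  refine measurableSet_setOf_comp (measurable_seen_apply hr t c v)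
    (P := fun i (ω : Sample C V) => ω.1 (c, v, i) = true) fun i => ?_
  exact measurableSet_eq_fun (by fun_prop) (by fun_prop)

/-- When the number of stories seen is `i`, neither it nor the topic has used the response with
index `i`; resampling that one coordinate splits off the factor `q`. -/
theorem law_topic_seen_response (hr : MeasurableRule r) (t : ℕ) (c : C) (v : V) (i : ℕ) :
    S.law μ {ω | (topic r ω t = c ∧ seen r ω t c v = i) ∧ ω.1 (c, v, i) = true} =
      ENNReal.ofReal (S.q c v) * S.law μ {ω | topic r ω t = c ∧ seen r ω t c v = i} := by
  classical
  have hE : MeasurableSet {ω : Sample C V | topic r ω t = c ∧ seen r ω t c v = i} :=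
    (measurableSet_topic hr t c).inter (measurable_seen_apply hr t c v (measurableSet_singleton i))
  have hF : MeasurableSet {y : C × V × ℕ → Bool | y (c, v, i) = true} :=
    measurableSet_eq_fun (by fun_prop) (by fun_prop)
  have hG : MeasurableSet {ω : Sample C V |
      (topic r ω t = c ∧ seen r ω t c v = i) ∧ ω.1 (c, v, i) = true} :=
    hE.inter (measurable_fst hF)
  rw [← lintegral_indicator_one hG, ← lintegral_indicator_one hE,
    S.lintegral_law_resample_feedback μ {(c, v, i)} (measurable_one.indicator hG),
    mul_comm, ← lintegral_mul_const _ (measurable_one.indicator hE)]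
  refine lintegral_congr fun ω => ?_
  have hq : ∫⁻ y, {y : C × V × ℕ → Bool | y (c, v, i) = true}.indicator 1 y ∂S.feedbackLaw =
      ENNReal.ofReal (S.q c v) := by
    have := (measurePreserving_eval_infinitePi (fun p : C × V × ℕ =>
      bernoulliMeasure true false (S.q p.1 p.2.1)) (c, v, i)).lintegral_comp
      (f := fun b => if b = true then 1 else 0) (measurable_of_countable _)
    rw [lintegral_bernoulliMeasure] at this
    simp only [Function.eval, if_true, Bool.false_eq_true, if_false, mul_one, mul_zero,
      add_zero] at this
    rw [← this]
    refine lintegral_congr fun y => ?_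
    simp [Set.indicator_apply]
  rw [← hq, ← lintegral_const_mul _ (measurable_one.indicator hF)]
  refine lintegral_congr fun y => ?_
  -- The two directions apply the same invariance, starting from either sample, since its hypothesis
  -- concerns only the starting one.
  have key : ∀ ω' : Sample C V, ω.2 = ω'.2 → (∀ p, p ≠ (c, v, i) → ω.1 p = ω'.1 p) →
      ((topic r ω' t = c ∧ seen r ω' t c v = i) ↔ (topic r ω t = c ∧ seen r ω t c v = i)) := by
    intro ω' h2 hY
    constructor
    · rintro ⟨h1, h5⟩
      obtain ⟨h3, h4⟩ := seen_congr_response r (fun p hp => (hY p hp).symm) h2.symm h5.le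
      exact ⟨h4 ▸ h1, h3 ▸ h5⟩
    · rintro ⟨h1, h5⟩
      obtain ⟨h3, h4⟩ := seen_congr_response r hY h2 h5.le
      exact ⟨h4 ▸ h1, h3 ▸ h5⟩
  exact indicator_one_eq_mul (and_congr
    (key _ rfl fun p hp => by simp [Set.piecewise, hp]) (by simp [Set.piecewise]))

theorem law_topic_response (hr : MeasurableRule r) (t : ℕ) (c : C) (v : V) :
    S.law μ {ω | topic r ω t = c ∧ response r ω t v = true} =
      ENNReal.ofReal (S.q c v) * S.law μ {ω | topic r ω t = c} := by
  have hE : ∀ i, MeasurableSet {ω : Sample C V | topic r ω t = c ∧ seen r ω t c v = i} := fun i =>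
    (measurableSet_topic hr t c).inter (measurable_seen_apply hr t c v (measurableSet_singleton i))
  have h1 : {ω : Sample C V | topic r ω t = c ∧ response r ω t v = true} =
      ⋃ i, {ω | (topic r ω t = c ∧ seen r ω t c v = i) ∧ ω.1 (c, v, i) = true} := by
    ext ω
    simp only [Set.mem_ofPred_eq, Set.mem_iUnion, response]
    constructor
    · rintro ⟨rfl, h⟩; exact ⟨_, ⟨rfl, rfl⟩, h⟩
    · rintro ⟨i, ⟨rfl, rfl⟩, h⟩; exact ⟨rfl, h⟩
  have h2 : {ω : Sample C V | topic r ω t = c} =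
      ⋃ i, {ω | topic r ω t = c ∧ seen r ω t c v = i} := by
    ext ω; simp
  rw [h1, h2, measure_iUnion _ hE, measure_iUnion, ← ENNReal.tsum_mul_left]
  · exact tsum_congr fun i => S.law_topic_seen_response μ hr t c v i
  · intro i j hij
    refine Set.disjoint_left.2 fun ω h h' => hij ?_
    exact h.1.2.symm.trans h'.1.2
  · intro i
    exact (hE i).inter (measurable_fst
      (measurableSet_eq_fun (by fun_prop) (by fun_prop) :
        MeasurableSet {y : C × V × ℕ → Bool | y (c, v, i) = true}))
  · intro i j hij
    refine Set.disjoint_left.2 fun ω h h' => hij ?_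
    exact h.2.symm.trans h'.2

theorem utility_eq (hr : MeasurableRule r) (T : ℕ) :
    S.utility μ r T = ∑ t ∈ Finset.range T, ∑ c, S.score S.trueQ c *
      (S.law μ).real {ω | topic r ω t = c} := by
  classical
  have hpt : ∀ ω : Sample C V, ∀ t,
      (∑ v, S.a v * (if response r ω t v = true then (1 : ℝ) else 0) + S.aU * S.x (topic r ω t)) =
      ∑ c, (∑ v, S.a v * {ω | topic r ω t = c ∧ response r ω t v = true}.indicator (fun _ => 1) ω
        + S.aU * S.x c * {ω | topic r ω t = c}.indicator (fun _ => 1) ω) := by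
    intro ω t
    rw [Finset.sum_eq_single (topic r ω t)]
    · simp [Set.indicator_apply]
    · intro c _ hc
      simp [hc.symm]
    · simp
  have hi1 : ∀ t c v, Integrable
      ({ω : Sample C V | topic r ω t = c ∧ response r ω t v = true}.indicator fun _ => (1 : ℝ))
      (S.law μ) := fun t c v =>
    (integrable_const _).indicator (measurableSet_topic_response hr t c v)
  have hi2 : ∀ t c, Integrable
      ({ω : Sample C V | topic r ω t = c}.indicator fun _ => (1 : ℝ)) (S.law μ) := fun t c =>
    (integrable_const _).indicator (measurableSet_topic hr t c)
  have hi3 : ∀ t c, Integrable (fun ω : Sample C V => ∑ v, S.a v *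
      {ω | topic r ω t = c ∧ response r ω t v = true}.indicator (fun _ => (1 : ℝ)) ω) (S.law μ) :=
    fun t c => integrable_finsetSum _ fun v _ => (hi1 t c v).const_mul _
  have hi4 : ∀ t c, Integrable (fun ω : Sample C V => ∑ v, S.a v *
      {ω | topic r ω t = c ∧ response r ω t v = true}.indicator (fun _ => (1 : ℝ)) ω +
        S.aU * S.x c * {ω | topic r ω t = c}.indicator (fun _ => 1) ω) (S.law μ) := fun t c =>
    (hi3 t c).add ((hi2 t c).const_mul _)
  unfold utility
  simp_rw [hpt]
  rw [integral_finsetSum _ fun t _ => integrable_finsetSum _ fun c _ => hi4 t c]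
  refine Finset.sum_congr rfl fun t _ => ?_
  rw [integral_finsetSum _ fun c _ => hi4 t c]
  refine Finset.sum_congr rfl fun c _ => ?_
  rw [integral_add (hi3 t c) ((hi2 t c).const_mul _), integral_const_mul,
    integral_indicator_const _ (measurableSet_topic hr t c),
    integral_finsetSum _ fun v _ => (hi1 t c v).const_mul _]
  simp_rw [integral_const_mul]
  have : ∀ v, ∫ ω, {ω | topic r ω t = c ∧ response r ω t v = true}.indicator (fun _ => (1 : ℝ)) ω
      ∂(S.law μ) = S.q c v * (S.law μ).real {ω | topic r ω t = c} := by
    intro v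
    rw [integral_indicator_const _ (measurableSet_topic_response hr t c v), measureReal_def,
      S.law_topic_response μ hr, ENNReal.toReal_mul, ENNReal.toReal_ofReal (S.q c v).2.1]
    simp [measureReal_def]
  simp_rw [this]
  rw [score, add_mul, Finset.sum_mul]
  simp [trueQ, mul_assoc]

theorem sum_law_topic (hr : MeasurableRule r) (t : ℕ) :
    ∑ c, (S.law μ).real {ω | topic r ω t = c} = 1 := by
  have h := measureReal_biUnion_finset (μ := S.law μ) (s := Finset.univ)
    (f := fun c => {ω : Sample C V | topic r ω t = c})
    (fun c _ c' _ h => Set.disjoint_left.2 fun ω h1 h2 => h (h1.symm.trans h2))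
    (fun c _ => measurableSet_topic hr t c)
  rw [← h]
  convert probReal_univ (μ := S.law μ)
  ext ω; simp

theorem regret_eq (T : ℕ) :
    S.regret μ T = ∑ t ∈ Finset.range T, ∑ c,
      (S.score S.trueQ (S.argmax S.trueQ) - S.score S.trueQ c) *
        (S.law μ).real {ω | topic S.thompson ω t = c} := by
  classical
  rw [regret, S.utility_eq μ S.measurableRule_optimal, S.utility_eq μ S.measurableRule_thompson,
    ← Finset.sum_sub_distrib]
  refine Finset.sum_congr rfl fun t _ => ?_
  simp_rw [sub_mul]
  rw [Finset.sum_sub_distrib, ← Finset.mul_sum, S.sum_law_topic μ S.measurableRule_thompson,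
    mul_one, Finset.sum_eq_single (S.argmax S.trueQ)]
  · congr 1
    rw [show {ω : Sample C V | topic S.optimal ω t = S.argmax S.trueQ} = Set.univ from
      Set.eq_univ_of_forall fun ω => rfl, probReal_univ, mul_one]
  · intro c _ hc
    rw [show {ω : Sample C V | topic S.optimal ω t = c} = ∅ from
      Set.eq_empty_of_forall_notMem fun ω h => hc (Eq.symm h), measureReal_empty, mul_zero]
  · simp

theorem mem_suboptimal {c : C} :
    c ∈ S.suboptimal ↔ S.score S.trueQ c < S.score S.trueQ (S.argmax S.trueQ) := by
  simp only [suboptimal, Finset.mem_filter, Finset.mem_univ, true_and]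
  exact ⟨fun ⟨c', h⟩ => h.trans_le (S.argmax_mem _ c'), fun h => ⟨_, h⟩⟩

/-- The gaps lie in `[0, 1]` and vanish off `S.suboptimal`, so the regret is also nonnegative. -/
theorem abs_regret_le (T : ℕ) :
    |S.regret μ T| ≤ ∑ t ∈ Finset.range T, ∑ c ∈ S.suboptimal,
      (S.law μ).real {ω | topic S.thompson ω t = c} := by
  rw [S.regret_eq, abs_of_nonneg]
  · refine Finset.sum_le_sum fun t _ => ?_
    rw [← Finset.sum_subset (Finset.subset_univ S.suboptimal)]
    · refine Finset.sum_le_sum fun c _ => mul_le_of_le_one_left measureReal_nonneg ?_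
      linarith [S.score_nonneg c, S.score_le_one (S.argmax S.trueQ)]
    · intro c _ hc
      rw [S.mem_suboptimal, not_lt] at hc
      rw [le_antisymm hc (S.argmax_mem _ c), sub_self, zero_mul]
  · exact Finset.sum_nonneg fun t _ => Finset.sum_nonneg fun c _ =>
      mul_nonneg (sub_nonneg.2 (S.argmax_mem _ c)) measureReal_nonneg

end Setting

/-! ### Counting posts; the early posts -/

section Plays

variable {C V : Type*} (r : Rule C V)

open Classical in
/-- The number of stories on topic `c` that the user shares before round `t`. -/
noncomputable def plays (ω : Sample C V) (c : C) (t : ℕ) : ℕ :=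
  ((Finset.range t).filter fun s => topic r ω s = c).card

/-- The number of stories of others on topic `c` that are shown to `v` before round `t`. -/
def others (m : ℕ × C × V → ℕ) (c : C) (v : V) (t : ℕ) : ℕ :=
  ∑ s ∈ Finset.range t, m (s, c, v)

open Classical in
theorem plays_succ (ω : Sample C V) (c : C) (t : ℕ) :
    plays r ω c (t + 1) = plays r ω c t + if topic r ω t = c then 1 else 0 := by
  rw [plays, Finset.range_add_one, Finset.filter_insert]
  split_ifs
  · rw [Finset.card_insert_of_notMem (by simp)]; rfl
  · rfl

theorem seen_eq (ω : Sample C V) (c : C) (v : V) (t : ℕ) :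
    seen r ω t c v = plays r ω c t + others ω.2.1 c v t := by
  induction t with
  | zero => rfl
  | succ t ih =>
    rw [seen_succ, ih, plays_succ, others, others, Finset.sum_range_succ]
    omega

open Classical in
/-- A sum over the rounds in which `c` is posted, reindexed by the number of earlier posts. -/
theorem sum_ite_topic_plays (ω : Sample C V) (c : C) (f : ℕ → ℝ≥0∞) (T : ℕ) :
    ∑ t ∈ Finset.range T, (if topic r ω t = c then f (plays r ω c t) else 0) =
      ∑ k ∈ Finset.range (plays r ω c T), f k := by
  induction T with
  | zero => simp [plays]
  | succ T ih =>
    rw [Finset.sum_range_succ, ih, plays_succ]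
    split_ifs
    · rw [Finset.sum_range_succ]
    · simp

/-- The draw that is made in round `t` for the preference of `v` for topic `c`. -/
noncomputable def estimate (ω : Sample C V) (t : ℕ) (c : C) (v : V) : ℝ :=
  ω.2.2 (t, c, v, hits ω.1 c v (seen r ω t c v) true, hits ω.1 c v (seen r ω t c v) false)

@[fun_prop]
theorem measurable_others (c : C) (v : V) (t : ℕ) :
    Measurable fun m : ℕ × C × V → ℕ => others m c v t := by
  unfold others; fun_prop

theorem measurable_comp_countable {Ω D E : Type*} [MeasurableSpace Ω] [MeasurableSpace D]
    [MeasurableSpace E] [Countable D] [MeasurableSingletonClass D] {f : Ω → D} (hf : Measurable f)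
    {F : D → Ω → E} (hF : ∀ d, Measurable (F d)) : Measurable fun ω => F (f ω) ω :=
  fun s hs => measurableSet_setOf_comp hf (P := fun d ω => F d ω ∈ s) fun d => hF d hs

variable {r} [Finite C] [Finite V]

theorem measurable_plays (hr : MeasurableRule r) (c : C) (t : ℕ) :
    Measurable fun ω : Sample C V => plays r ω c t := by
  classical
  induction t with
  | zero => simp [plays]
  | succ t ih =>
    simp only [plays_succ]
    exact ih.add (Measurable.ite (measurableSet_topic hr t c) measurable_const measurable_const)

theorem measurable_estimate (hr : MeasurableRule r) (t : ℕ) (c : C) (v : V) :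
    Measurable fun ω : Sample C V => estimate r ω t c v := by
  refine measurable_comp_countable (measurable_seen_apply hr t c v)
    (F := fun k ω => ω.2.2 (t, c, v, hits ω.1 c v k true, hits ω.1 c v k false)) fun k => ?_
  refine measurable_comp_countable ((measurable_hits c v k true).comp measurable_fst)
    (F := fun n (ω : Sample C V) => ω.2.2 (t, c, v, n, hits ω.1 c v k false)) fun n => ?_
  exact measurable_comp_countable ((measurable_hits c v k false).comp measurable_fst)
    (F := fun m (ω : Sample C V) => ω.2.2 (t, c, v, n, m)) fun m => by fun_prop

/-- The count of earlier posts takes each value at most once among the rounds that post `c`, so the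
bound holds in every run. -/
theorem sum_law_topic_plays_lt [Fintype V] (S : Setting C V) (μ : C → V → ℝ≥0)
    (hr : MeasurableRule r) (c : C) (L T : ℕ) :
    ∑ t ∈ Finset.range T, S.law μ {ω | topic r ω t = c ∧ plays r ω c t < L} ≤ L := by
  classical
  have hm : ∀ t, MeasurableSet {ω : Sample C V | topic r ω t = c ∧ plays r ω c t < L} := fun t =>
    (measurableSet_topic hr t c).inter (measurable_plays hr c t measurableSet_Iio)
  simp_rw [← fun t => lintegral_indicator_one (μ := S.law μ) (hm t)]
  rw [← lintegral_finsetSum _ fun t _ => measurable_one.indicator (hm t)]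
  refine (lintegral_mono (g := fun _ => (L : ℝ≥0∞)) fun ω => ?_).trans (by simp)
  have h : ∀ t, {ω : Sample C V | topic r ω t = c ∧ plays r ω c t < L}.indicator 1 ω =
      if topic r ω t = c then (if plays r ω c t < L then (1 : ℝ≥0∞) else 0) else 0 := by
    intro t
    simp only [Set.indicator_apply, Set.mem_ofPred_eq, Pi.one_apply]
    split_ifs <;> simp_all
  simp_rw [h]
  rw [sum_ite_topic_plays r ω c (fun k => if k < L then 1 else 0), Finset.sum_ite,
    Finset.sum_const_zero, add_zero, Finset.sum_const, nsmul_one]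
  refine Nat.cast_le.2 ((Finset.card_le_card (t := Finset.range L) fun k hk => ?_).trans
    (Finset.card_range L).le)
  exact Finset.mem_range.2 (Finset.mem_filter.1 hk).2

end Plays

/-! ### Overestimates of a suboptimal topic -/

theorem tsum_ite_le (k : ℕ) (f : ℕ → ℝ≥0∞) :
    ∑' n, (if k ≤ n then f n else 0) = ∑' j, f (k + j) := by
  have h := (add_right_injective k).tsum_eq (f := fun n => if k ≤ n then f n else 0)
    (fun n hn => by
      have : k ≤ n := by by_contra h; simp [h] at hn
      exact ⟨n - k, by simp only; omega⟩)
  rw [← h]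
  simp

theorem tsum_ite_le_pow (k : ℕ) (x : ℝ≥0∞) :
    ∑' n, (if k ≤ n then x ^ n else 0) = x ^ k * (1 - x)⁻¹ := by
  rw [tsum_ite_le]
  simp_rw [pow_add]
  rw [ENNReal.tsum_mul_left, ENNReal.tsum_geometric]

namespace Setting

variable {C V : Type*} [Fintype V] (S : Setting C V) (μ : C → V → ℝ≥0) {r : Rule C V}

theorem lintegral_law_mul {f : (C × V × ℕ → Bool) → ℝ≥0∞} {g : (ℕ × C × V → ℕ) → ℝ≥0∞}
    (hf : Measurable f) (hg : Measurable g) :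
    ∫⁻ ω, f ω.1 * g ω.2.1 ∂S.law μ = (∫⁻ y, f y ∂S.feedbackLaw) * ∫⁻ m, g m ∂storyLaw μ := by
  have hg' : Measurable fun p : (ℕ × C × V → ℕ) × (ℕ × C × V × ℕ × ℕ → ℝ) => g p.1 := by fun_prop
  have h := lintegral_prod_mul (μ := S.feedbackLaw) (ν := (storyLaw μ).prod S.drawLaw)
    hf.aemeasurable hg'.aemeasurable
  rw [law_eq, h, (measurePreserving_fst (μ := storyLaw μ) (ν := S.drawLaw)).lintegral_comp hg]

omit [Fintype V] in
theorem lintegral_pow_others {ρ : ℝ} (hρ : 0 ≤ ρ) (c : C) (v : V) (t : ℕ) :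
    ∫⁻ m, ENNReal.ofReal ρ ^ others m c v t ∂storyLaw μ =
      ENNReal.ofReal (Real.exp (-(μ c v * (1 - ρ)))) ^ t := by
  simp_rw [others, ← Finset.prod_pow_eq_pow_sum]
  rw [storyLaw, lintegral_infinitePi_prod_eval
    (fun p : ℕ × C × V => poissonMeasure (μ p.2.1 p.2.2)) (Finset.range t)
    (fun s => (s, c, v)) (fun s s' h => by simpa using h) (f := fun _ n => ENNReal.ofReal ρ ^ n)
    (fun _ => measurable_of_countable _)]
  simp [lintegral_pow_poissonMeasure _ hρ]

/-- The lower limit of the sum depends only on the stories of others, so each term factors. What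
remains is a geometric tail and the generating function of the Poisson counts. -/
theorem lintegral_tsum_overProb_le {ε ρ : ℝ} {K : ℝ≥0} (hρ : 0 ≤ ρ) {c : C} {v : V}
    (hK : ∀ n, ∫⁻ y, S.overProb ε y c v n ∂S.feedbackLaw ≤ K * ENNReal.ofReal ρ ^ n) (L t : ℕ) :
    ∫⁻ ω, ∑' n, (if L + others ω.2.1 c v t ≤ n then S.overProb ε ω.1 c v n else 0) ∂S.law μ ≤
      K * (ENNReal.ofReal ρ ^ L * (1 - ENNReal.ofReal ρ)⁻¹ *
        ENNReal.ofReal (Real.exp (-(μ c v * (1 - ρ)))) ^ t) := by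
  have hm : ∀ n, Measurable fun m : ℕ × C × V → ℕ =>
      if L + others m c v t ≤ n then (1 : ℝ≥0∞) else 0 := fun n =>
    Measurable.ite (measurableSet_le (by fun_prop) (by fun_prop)) measurable_const measurable_const
  have h1 : ∀ n (ω : Sample C V),
      (if L + others ω.2.1 c v t ≤ n then S.overProb ε ω.1 c v n else 0) =
      S.overProb ε ω.1 c v n * (if L + others ω.2.1 c v t ≤ n then 1 else 0) := by
    intro n ω; split_ifs <;> simp
  simp_rw [h1]
  have hm2 : ∀ n, Measurable fun ω : Sample C V =>
      S.overProb ε ω.1 c v n * (if L + others ω.2.1 c v t ≤ n then 1 else 0) := fun n =>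
    ((S.measurable_overProb ε c v n).comp measurable_fst).mul
      ((hm n).comp (measurable_fst.comp measurable_snd))
  rw [lintegral_tsum fun n => (hm2 n).aemeasurable]
  calc ∑' n, ∫⁻ ω, S.overProb ε ω.1 c v n *
        (if L + others ω.2.1 c v t ≤ n then 1 else 0) ∂S.law μ
      = ∑' n, (∫⁻ y, S.overProb ε y c v n ∂S.feedbackLaw) *
          ∫⁻ m, (if L + others m c v t ≤ n then 1 else 0) ∂storyLaw μ :=
        tsum_congr fun n => S.lintegral_law_mul μ (S.measurable_overProb ε c v n) (hm n)
    _ ≤ ∑' n, K * ENNReal.ofReal ρ ^ n *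
          ∫⁻ m, (if L + others m c v t ≤ n then 1 else 0) ∂storyLaw μ := by
        gcongr with n; exact hK n
    _ = K * ∫⁻ m, ∑' n, (if L + others m c v t ≤ n then ENNReal.ofReal ρ ^ n else 0)
          ∂storyLaw μ := by
        rw [lintegral_tsum fun n => (Measurable.ite (measurableSet_le (by fun_prop) (by fun_prop))
          measurable_const measurable_const).aemeasurable, ← ENNReal.tsum_mul_left]
        refine tsum_congr fun n => ?_
        rw [mul_assoc, ← lintegral_const_mul _ (hm n)]
        congr 1
        refine lintegral_congr fun m => ?_
        split_ifs <;> simp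
    _ = _ := by
        simp_rw [tsum_ite_le_pow, pow_add, mul_right_comm _ _ ((1 - ENNReal.ofReal ρ)⁻¹)]
        rw [lintegral_const_mul _ (by fun_prop), lintegral_pow_others μ hρ]

/-- Replace the draws of round `t`. -/
def redraw {C V : Type*} (t : ℕ) (b : ℕ × C × V × ℕ × ℕ → ℝ) (ω : Sample C V) : Sample C V :=
  (ω.1, ω.2.1, fun p => if p.1 = t then b p else ω.2.2 p)

theorem lintegral_law_redraw (t : ℕ) {f : Sample C V → ℝ≥0∞} (hf : Measurable f) :
    ∫⁻ ω, f ω ∂S.law μ = ∫⁻ ω, ∫⁻ b, f (redraw t b ω) ∂S.drawLaw ∂S.law μ := by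
  rw [S.lintegral_law_resample_draws μ {p | p.1 = t} hf]
  refine lintegral_congr fun ω => lintegral_congr fun b => ?_
  congr 3
  funext p
  simp [Set.piecewise]

variable [Fintype C]

/-- Redrawing round `t` leaves the history fixed, and the draw then has the posterior law. The
number of responses seen is one of the `n` in the sum. -/
theorem law_estimate_le (hr : MeasurableRule r) (ε : ℝ) (c : C) (v : V) (L t : ℕ) :
    S.law μ {ω | L ≤ plays r ω c t ∧ S.q c v + ε < estimate r ω t c v} ≤
      ∫⁻ ω, ∑' n, (if L + others ω.2.1 c v t ≤ n then S.overProb ε ω.1 c v n else 0) ∂S.law μ := by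
  classical
  have hle : S.law μ {ω | L ≤ plays r ω c t ∧ S.q c v + ε < estimate r ω t c v} ≤
      S.law μ {ω | L + others ω.2.1 c v t ≤ seen r ω t c v ∧
        S.q c v + ε < estimate r ω t c v} := by
    refine measure_mono fun ω h => ⟨?_, h.2⟩
    rw [seen_eq]
    exact Nat.add_le_add_right h.1 _
  have hG : MeasurableSet {ω : Sample C V | L + others ω.2.1 c v t ≤ seen r ω t c v ∧
      S.q c v + ε < estimate r ω t c v} :=
    (measurableSet_le (by fun_prop) (measurable_seen_apply hr t c v)).inter
      (measurableSet_lt measurable_const (measurable_estimate hr t c v))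
  refine hle.trans ?_
  rw [← lintegral_indicator_one hG,
    S.lintegral_law_redraw μ t (measurable_one.indicator hG)]
  refine lintegral_mono fun ω => ?_
  set N := seen r ω t c v with hN
  set F : Set (ℕ × C × V × ℕ × ℕ → ℝ) :=
    {b | S.q c v + ε < b (t, c, v, hits ω.1 c v N true, hits ω.1 c v N false)} with hF
  have hFm : MeasurableSet F := measurableSet_lt measurable_const (by fun_prop)
  have hFp : S.drawLaw F = S.overProb ε ω.1 c v N :=
    (measurePreserving_eval_infinitePi (fun p : ℕ × C × V × ℕ × ℕ =>
      betaMeasure (S.α + (p.2.2.2.1 : ℝ)) (S.β + (p.2.2.2.2 : ℝ)))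
      (t, c, v, hits ω.1 c v N true, hits ω.1 c v N false)).measure_preimage
      measurableSet_Ioi.nullMeasurableSet
  have hpt : ∀ b, ∀ ω' : Sample C V, ω'.1 = ω.1 → ω'.2.1 = ω.2.1 →
      (∀ s ≠ t, ∀ p, ω'.2.2 (s, p) = ω.2.2 (s, p)) → (∀ p, ω'.2.2 (t, p) = b (t, p)) →
      ({ω : Sample C V | L + others ω.2.1 c v t ≤ seen r ω t c v ∧
        S.q c v + ε < estimate r ω t c v}.indicator 1 ω' : ℝ≥0∞) =
      (if L + others ω.2.1 c v t ≤ N then 1 else 0) * F.indicator 1 b := by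
    intro b ω' h1 h2 h3 h4
    have hs : seen r ω' t = seen r ω t := seen_congr_draws r h1 h2 fun s hs => h3 s hs.ne
    have : ω' ∈ {ω : Sample C V | L + others ω.2.1 c v t ≤ seen r ω t c v ∧
        S.q c v + ε < estimate r ω t c v} ↔ L + others ω.2.1 c v t ≤ N ∧ b ∈ F := by
      simp only [Set.mem_ofPred_eq, estimate, hs, h1, h2, h4, hF, hN]
    simp only [Set.indicator_apply, this, Pi.one_apply]
    by_cases h5 : L + others ω.2.1 c v t ≤ N <;> by_cases h6 : b ∈ F <;>
      simp only [h5, h6, and_true, and_false, if_true, if_false, mul_one, mul_zero]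
  rw [lintegral_congr fun b => hpt b (redraw t b ω) rfl rfl
    (fun s hs p => by simp [redraw, hs]) (fun p => by simp [redraw]),lintegral_const_mul _ (measurable_one.indicator hFm), lintegral_indicator_one hFm, hFp,
    ite_mul, one_mul, zero_mul]
  exact ENNReal.le_tsum (f := fun n => if L + others ω.2.1 c v t ≤ n then
    S.overProb ε ω.1 c v n else 0) N

end Setting

/-! ### Underestimates of the optimal topic -/

namespace Setting

variable {C V : Type*} [Fintype V] (S : Setting C V) (μ : C → V → ℝ≥0)

theorem sum_a_le_one : ∑ v, S.a v ≤ 1 := by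
  linarith [S.sum_weights, S.aU_nonneg]

theorem score_sub_le {p : C → V → ℝ} {c : C} {ε : ℝ} (hε : 0 ≤ ε)
    (h : ∀ v, S.q c v - ε ≤ p c v) : S.score S.trueQ c - ε ≤ S.score p c := by
  have h1 : ∑ v, S.a v * ((S.q c v : ℝ) - ε) ≤ ∑ v, S.a v * p c v :=
    Finset.sum_le_sum fun v _ => mul_le_mul_of_nonneg_left (h v) (S.a_nonneg v)
  simp_rw [mul_sub, Finset.sum_sub_distrib, ← Finset.sum_mul] at h1
  have := mul_le_mul_of_nonneg_right S.sum_a_le_one hε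
  simp only [score, trueQ]
  linarith

theorem score_le_add {p : C → V → ℝ} {c : C} {ε : ℝ} (hε : 0 ≤ ε)
    (h : ∀ v, p c v ≤ S.q c v + ε) : S.score p c ≤ S.score S.trueQ c + ε := by
  have h1 : ∑ v, S.a v * p c v ≤ ∑ v, S.a v * ((S.q c v : ℝ) + ε) :=
    Finset.sum_le_sum fun v _ => mul_le_mul_of_nonneg_left (h v) (S.a_nonneg v)
  simp_rw [mul_add, Finset.sum_add_distrib, ← Finset.sum_mul] at h1
  have := mul_le_mul_of_nonneg_right S.sum_a_le_one hε
  simp only [score, trueQ]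
  linarith

/-- The odds against drawing no preference for topic `c` that is too low by `ε`. -/
noncomputable def failOdds (ε : ℝ) (y : C × V × ℕ → Bool) (c : C) (N : V → ℕ) : ℝ≥0∞ :=
  ∏ v, (1 + S.underOdds ε y c v (N v)) - 1

/-- A bound of `failOdds` that holds for all histories with at least `k` responses of everyone. -/
noncomputable def failOddsFrom (ε : ℝ) (y : C × V × ℕ → Bool) (c : C) (k : ℕ) : ℝ≥0∞ :=
  ∏ v, (1 + ∑' n, if k ≤ n then S.underOdds ε y c v n else 0) - 1

/-- Removes the counts `N`, which depend on the responses in a run, so that the mean over the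
responses can be taken. -/
theorem failOdds_le (ε : ℝ) (y : C × V × ℕ → Bool) (c : C) {N : V → ℕ} {k : ℕ}
    (h : ∀ v, k ≤ N v) : S.failOdds ε y c N ≤ S.failOddsFrom ε y c k := by
  unfold failOdds failOddsFrom
  gcongr with v
  refine le_trans (by rw [if_pos (h v)])
    (ENNReal.le_tsum (f := fun n => if k ≤ n then S.underOdds ε y c v n else 0) (N v))

theorem measurable_failOdds (ε : ℝ) (c : C) (N : V → ℕ) :
    Measurable fun y => S.failOdds ε y c N := by
  unfold failOdds
  exact (Finset.measurable_prod _ fun v _ => by fun_prop).sub_const _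

theorem measurable_tsum_underOdds (ε : ℝ) (c : C) (v : V) (k : ℕ) :
    Measurable fun y => ∑' n, if k ≤ n then S.underOdds ε y c v n else 0 :=
  Measurable.tsum fun n => by split_ifs <;> fun_prop

/-- The draws of one round for one topic are all large with the expected probability. -/
theorem drawLaw_forall_lt {ε : ℝ} (hε : 0 < ε) (t : ℕ) (y : C × V × ℕ → Bool) (N : V → ℕ)
    (c : C) :
    S.drawLaw {b | ∀ v, S.q c v - ε < b (t, c, v, hits y c v (N v) true, hits y c v (N v) false)} =
      (∏ v, (1 + S.underOdds ε y c v (N v)))⁻¹ := by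
  set e : V → ℕ × C × V × ℕ × ℕ := fun v =>
    (t, c, v, hits y c v (N v) true, hits y c v (N v) false) with he
  have hH : MeasurableSet {b : ℕ × C × V × ℕ × ℕ → ℝ | ∀ v, S.q c v - ε < b (e v)} := by
    rw [Set.ofPred_forall]
    exact MeasurableSet.iInter fun v => measurableSet_lt measurable_const (by fun_prop)
  have h1 : ∀ b : ℕ × C × V × ℕ × ℕ → ℝ,
      ({b | ∀ v, S.q c v - ε < b (e v)}.indicator 1 b : ℝ≥0∞) =
      ∏ v, (Set.Ioi ((S.q c v : ℝ) - ε)).indicator 1 (b (e v)) := by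
    intro b
    by_cases h : ∀ v, S.q c v - ε < b (e v)
    · rw [Set.indicator_of_mem (s := {b : ℕ × C × V × ℕ × ℕ → ℝ | ∀ v, S.q c v - ε < b (e v)}) h, Finset.prod_eq_one]
      · rfl
      · intro v _
        exact Set.indicator_of_mem (Set.mem_Ioi.2 (h v)) 1
    · rw [Set.indicator_of_notMem (s := {b : ℕ × C × V × ℕ × ℕ → ℝ | ∀ v, S.q c v - ε < b (e v)}) h]
      push Not at h
      obtain ⟨v, hv⟩ := h
      rw [Finset.prod_eq_zero (Finset.mem_univ v)]
      exact Set.indicator_of_notMem (by simpa using hv) _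
  rw [← lintegral_indicator_one hH, lintegral_congr h1, drawLaw,
    lintegral_infinitePi_prod_eval (fun p : ℕ × C × V × ℕ × ℕ =>
      betaMeasure (S.α + (p.2.2.2.1 : ℝ)) (S.β + (p.2.2.2.2 : ℝ))) Finset.univ e
      (fun v w h => by simp only [he, Prod.mk.injEq] at h; exact h.2.2.1)
      (f := fun v => (Set.Ioi ((S.q c v : ℝ) - ε)).indicator 1)
      (fun v => measurable_one.indicator measurableSet_Ioi), ENNReal.prod_inv_distrib]
  · refine Finset.prod_congr rfl fun v _ => ?_
    rw [lintegral_indicator_one measurableSet_Ioi, S.one_add_underOdds hε, inv_inv]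
    rfl
  · intro v _ w _ _
    left
    simp

variable [Fintype C]

/-- If the scores of the other topics are low then a low draw for `c₀` is at most `failOdds` times
as likely as a high draw, after which `c₀` is posted. -/
theorem drawLaw_low_le {ε x : ℝ} (hε : 0 < ε) (t : ℕ) (y : C × V × ℕ → Bool) (N : C → V → ℕ)
    {c c₀ : C} (hx : x < S.score S.trueQ c₀ - ε) {p : (ℕ × C × V × ℕ × ℕ → ℝ) → C → V → ℝ}
    (hp : ∀ b c v, p b c v =
      b (t, c, v, hits y c v (N c v) true, hits y c v (N c v) false)) :
    S.drawLaw {b | S.argmax (p b) = c ∧ S.score (p b) c ≤ x} ≤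
      S.failOdds ε y c₀ (N c₀) * S.drawLaw {b | S.argmax (p b) = c₀} := by
  classical
  have hpm : ∀ c v, Measurable fun b => p b c v := fun c v => by simp_rw [hp]; fun_prop
  set M : Set (ℕ × C × V × ℕ × ℕ → ℝ) := {b | ∀ c', c' ≠ c₀ → S.score (p b) c' ≤ x} with hM
  set H : Set (ℕ × C × V × ℕ × ℕ → ℝ) := {b | ∀ v, S.q c₀ v - ε < p b c₀ v} with hH
  have hMm : MeasurableSet M := by
    rw [hM, Set.ofPred_forall]
    refine MeasurableSet.iInter fun c' => ?_
    by_cases h : c' = c₀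
    · simp [h]
    · simpa [h] using measurableSet_le (S.measurable_score hpm c') measurable_const
  have hHm : MeasurableSet H := by
    rw [hH, Set.ofPred_forall]
    exact MeasurableSet.iInter fun v => measurableSet_lt measurable_const (hpm _ _)
  have hscore : ∀ b ∈ H, x < S.score (p b) c₀ := fun b hb =>
    hx.trans_le (S.score_sub_le hε.le fun v => (hb v).le)
  -- `M` involves only draws for topics other than `c₀`, and `H'` only those for `c₀`.
  have hindep : ∀ H' : Set (ℕ × C × V × ℕ × ℕ → ℝ), MeasurableSet H' →
      (∀ b b', (∀ v, p b c₀ v = p b' c₀ v) → (b ∈ H' ↔ b' ∈ H')) →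
      S.drawLaw (M ∩ H') = S.drawLaw M * S.drawLaw H' := by
    intro H' hm' hd
    rw [← lintegral_indicator_one (hMm.inter hm'), ← lintegral_indicator_one hMm,
      ← lintegral_indicator_one hm', drawLaw, ← lintegral_infinitePi_mul _
      (measurable_one.indicator hMm) (measurable_one.indicator hm') (s := {q | q.2.1 ≠ c₀})
      (t := {q | q.2.1 = c₀})]
    · exact lintegral_congr fun b => indicator_one_eq_mul Iff.rfl
    · intro b b' h
      have : b ∈ M ↔ b' ∈ M := by
        refine forall_congr' fun c' => forall_congr' fun hc' => ?_
        have h' : ∀ v, p b c' v = p b' c' v := fun v => by rw [hp, hp]; exact h _ hc'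
        simp only [score, h']
      simp only [Set.indicator_apply, this, Pi.one_apply]
    · intro b b' h
      have := hd b b' fun v => by rw [hp, hp]; exact h _ rfl
      simp only [Set.indicator_apply, this, Pi.one_apply]
    · exact Set.disjoint_left.2 fun q h h' => h h'
  have hH0 : S.drawLaw H = (∏ v, (1 + S.underOdds ε y c₀ v (N c₀ v)))⁻¹ := by
    rw [← S.drawLaw_forall_lt hε t y (N c₀) c₀]
    simp only [hH, hp]
  have hle1 : {b | S.argmax (p b) = c ∧ S.score (p b) c ≤ x} ⊆ M ∩ Hᶜ := by
    rintro b ⟨h1, h2⟩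
    have h3 : ∀ c', S.score (p b) c' ≤ x := fun c' =>
      (S.argmax_mem (p b) c').trans (by rw [h1]; exact h2)
    exact ⟨fun c' _ => h3 c', fun hb => (hscore b hb).not_ge (h3 c₀)⟩
  have hle2 : M ∩ H ⊆ {b | S.argmax (p b) = c₀} := by
    rintro b ⟨h1, h2⟩
    by_contra h
    exact ((hscore b h2).trans_le (S.argmax_mem (p b) c₀)).not_ge (h1 _ h)
  have hdep : ∀ b b' : ℕ × C × V × ℕ × ℕ → ℝ, (∀ v, p b c₀ v = p b' c₀ v) → (b ∈ H ↔ b' ∈ H) :=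
    fun b b' h => by simp only [hH, Set.mem_ofPred_eq, h]
  have h0 : S.drawLaw H ≠ 0 := by
    rw [hH0]
    simp only [ne_eq, ENNReal.inv_eq_zero]
    refine ENNReal.prod_ne_top fun v _ => ?_
    rw [S.one_add_underOdds hε]
    exact ENNReal.inv_ne_top.2 (S.posterior_Ioi_ne_zero hε _ _ _ _)
  -- With `p` the probability of `H`, `failOdds` equals `1 / p - 1`, so its product with `p` is the
  -- probability of `Hᶜ`.
  calc S.drawLaw {b | S.argmax (p b) = c ∧ S.score (p b) c ≤ x}
      ≤ S.drawLaw M * S.drawLaw Hᶜ := (measure_mono hle1).trans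
        (hindep _ hHm.compl fun b b' h => not_congr (hdep b b' h)).le
    _ = S.failOdds ε y c₀ (N c₀) * (S.drawLaw M * S.drawLaw H) := by
        rw [failOdds, ← inv_inv (∏ v, _), ← hH0, mul_left_comm,
          ENNReal.sub_mul (fun _ _ => measure_ne_top _ _), one_mul,
          ENNReal.inv_mul_cancel h0 (measure_ne_top _ _), prob_compl_eq_one_sub hHm]
    _ ≤ _ := by
        rw [← hindep H hHm hdep]
        gcongr

theorem measurable_failOdds_mul_topic (ε : ℝ) (c : C) (t : ℕ) :
    Measurable fun ω : Sample C V => S.failOdds ε ω.1 c (seen S.thompson ω t c) *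
      {ω | topic S.thompson ω t = c}.indicator 1 ω := by
  have hr := S.measurableRule_thompson
  have hW : Measurable fun ω : Sample C V => S.failOdds ε ω.1 c (seen S.thompson ω t c) :=
    measurable_comp_countable (measurable_seen hr t)
      (F := fun N ω => S.failOdds ε ω.1 c (N c))
      fun N => (S.measurable_failOdds ε c (N c)).comp measurable_fst
  exact hW.mul (measurable_one.indicator (measurableSet_topic hr t c))

/-- `drawLaw_low_le` averaged over the history, after redrawing round `t` on both sides. -/
theorem law_topic_score_le {ε x : ℝ} (hε : 0 < ε) (t : ℕ) {c c₀ : C}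
    (hx : x < S.score S.trueQ c₀ - ε) :
    S.law μ {ω | topic S.thompson ω t = c ∧ S.score (estimate S.thompson ω t) c ≤ x} ≤
      ∫⁻ ω, S.failOdds ε ω.1 c₀ (seen S.thompson ω t c₀) *
        {ω | topic S.thompson ω t = c₀}.indicator 1 ω ∂S.law μ := by
  classical
  have hr := S.measurableRule_thompson
  have hE : MeasurableSet {ω : Sample C V | topic S.thompson ω t = c ∧
      S.score (estimate S.thompson ω t) c ≤ x} :=
    (measurableSet_topic hr t c).inter (measurableSet_le
      (S.measurable_score (fun c v => measurable_estimate hr t c v) c) measurable_const)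
  rw [← lintegral_indicator_one hE, S.lintegral_law_redraw μ t (measurable_one.indicator hE),
    S.lintegral_law_redraw μ t (S.measurable_failOdds_mul_topic ε c₀ t)]
  refine lintegral_mono fun ω => ?_
  set N := seen S.thompson ω t with hN
  set p : (ℕ × C × V × ℕ × ℕ → ℝ) → C → V → ℝ := fun b c v =>
    b (t, c, v, hits ω.1 c v (N c v) true, hits ω.1 c v (N c v) false) with hp
  have hs : ∀ b, seen S.thompson (redraw t b ω) t = N := fun b =>
    seen_congr_draws _ rfl rfl fun s hs q => by simp [redraw, hs.ne]
  have he : ∀ b, estimate S.thompson (redraw t b ω) t = p b := fun b => by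
    funext c v
    rw [estimate, hs]
    simp [redraw, hp]
  have ht : ∀ b, topic S.thompson (redraw t b ω) t = S.argmax (p b) := fun b => by
    rw [← he b]
    simp only [topic, choice, thompson]
    rfl
  have hpm : ∀ c v, Measurable fun b => p b c v := fun c v => by simp only [hp]; fun_prop
  have h1 : ∀ b, ({ω : Sample C V | topic S.thompson ω t = c ∧
      S.score (estimate S.thompson ω t) c ≤ x}.indicator 1 (redraw t b ω) : ℝ≥0∞) =
      {b | S.argmax (p b) = c ∧ S.score (p b) c ≤ x}.indicator 1 b := fun b => by
    simp only [Set.indicator_apply, Set.mem_ofPred_eq, ht, he, Pi.one_apply]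
  have h2 : ∀ b, S.failOdds ε (redraw t b ω).1 c₀ (seen S.thompson (redraw t b ω) t c₀) *
      {ω : Sample C V | topic S.thompson ω t = c₀}.indicator 1 (redraw t b ω) =
      S.failOdds ε ω.1 c₀ (N c₀) * {b | S.argmax (p b) = c₀}.indicator 1 b := fun b => by
    simp only [Set.indicator_apply, Set.mem_ofPred_eq, ht, hs, Pi.one_apply]
    rfl
  have hEm : MeasurableSet {b | S.argmax (p b) = c ∧ S.score (p b) c ≤ x} :=
    (S.measurableSet_argmax hpm c).inter
      (measurableSet_le (S.measurable_score hpm c) measurable_const)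
  rw [lintegral_congr h1, lintegral_congr h2, lintegral_indicator_one hEm,
    lintegral_const_mul _ (measurable_one.indicator (S.measurableSet_argmax hpm c₀)),
    lintegral_indicator_one (S.measurableSet_argmax hpm c₀)]
  exact S.drawLaw_low_le hε t ω.1 N hx fun _ _ _ => rfl

/-- The right side of `law_topic_score_le` charges only rounds that post `c₀`. The post with `k`
predecessors comes with at least `k` responses of every follower and occurs at most once, so the sum
over rounds becomes a sum over `k`, free of `T`. -/
theorem sum_law_topic_score_le {ε x : ℝ} (hε : 0 < ε) {c c₀ : C}
    (hx : x < S.score S.trueQ c₀ - ε) (T : ℕ) :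
    ∑ t ∈ Finset.range T,
      S.law μ {ω | topic S.thompson ω t = c ∧ S.score (estimate S.thompson ω t) c ≤ x} ≤
      ∑' k, ∫⁻ y, S.failOddsFrom ε y c₀ k ∂S.feedbackLaw := by
  classical
  have hr := S.measurableRule_thompson
  have hF : ∀ k, Measurable fun y => S.failOddsFrom ε y c₀ k := fun k =>
    (Finset.measurable_prod _ fun v _ =>
      measurable_const.add (S.measurable_tsum_underOdds ε c₀ v k)).sub_const _
  refine (Finset.sum_le_sum fun t _ => S.law_topic_score_le μ hε t hx).trans ?_
  rw [← lintegral_finsetSum _ fun t _ => S.measurable_failOdds_mul_topic ε c₀ t,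
    ← lintegral_tsum fun k => (hF k).aemeasurable,
    ← (measurePreserving_fst (μ := S.feedbackLaw)
      (ν := (storyLaw μ).prod S.drawLaw)).lintegral_comp (Measurable.tsum hF), ← law_eq]
  refine lintegral_mono fun ω => ?_
  calc ∑ t ∈ Finset.range T, S.failOdds ε ω.1 c₀ (seen S.thompson ω t c₀) *
        {ω | topic S.thompson ω t = c₀}.indicator 1 ω
      ≤ ∑ t ∈ Finset.range T, if topic S.thompson ω t = c₀ then
          S.failOddsFrom ε ω.1 c₀ (plays S.thompson ω c₀ t) else 0 := by
        refine Finset.sum_le_sum fun t _ => ?_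
        simp only [Set.indicator_apply, Set.mem_ofPred_eq, Pi.one_apply]
        split_ifs
        · rw [mul_one]
          refine S.failOdds_le ε ω.1 c₀ fun v => ?_
          rw [seen_eq]
          exact Nat.le_add_right _ _
        · simp
    _ = _ := sum_ite_topic_plays _ ω c₀ (S.failOddsFrom ε ω.1 c₀) T
    _ ≤ _ := ENNReal.sum_le_tsum _

omit [Fintype C] in
theorem exists_tsum_lintegral_failOddsFrom_le {ε ρ : ℝ} {K : ℝ≥0} (hρ : ρ < 1) (c : C)
    (hK : ∀ v n, ∫⁻ y, S.underOdds ε y c v n ∂S.feedbackLaw ≤ K * ENNReal.ofReal ρ ^ n) :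
    ∃ B : ℝ≥0, ∑' k, ∫⁻ y, S.failOddsFrom ε y c k ∂S.feedbackLaw ≤ B := by
  set r := ENNReal.ofReal ρ with hr
  have hr1 : r < 1 := by simpa [hr] using hρ
  set b : ℝ≥0∞ := K * (1 - r)⁻¹ with hb
  have hinv : (1 - r)⁻¹ ≠ ∞ := ENNReal.inv_ne_top.2 (tsub_pos_of_lt hr1).ne'
  have hbt : b ≠ ∞ := ENNReal.mul_ne_top ENNReal.coe_ne_top hinv
  -- By convexity `(1 + a b)^m - 1` is at most `a` times its value at `a = 1`. With `a = r ^ k` this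
  -- keeps the geometric decay when the factors of all followers are multiplied.
  have hpow : ∀ a : ℝ≥0∞, a ≤ 1 → ∀ m : ℕ, (1 + a * b) ^ m ≤ 1 + a * ((1 + b) ^ m - 1) := by
    intro a ha m
    induction m with
    | zero => simp
    | succ m ih =>
      have h1 : (1 : ℝ≥0∞) ≤ (1 + b) ^ m := one_le_pow₀ le_self_add
      obtain ⟨D, hD⟩ := exists_add_of_le h1
      rw [hD, ENNReal.add_sub_cancel_left ENNReal.one_ne_top] at ih
      rw [pow_succ, pow_succ, hD, show (1 + D) * (1 + b) = 1 + (b + D + b * D) by ring,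
        ENNReal.add_sub_cancel_left ENNReal.one_ne_top]
      calc (1 + a * b) ^ m * (1 + a * b) ≤ (1 + a * D) * (1 + a * b) := by gcongr
        _ = 1 + a * (b + D + a * (b * D)) := by ring
        _ ≤ 1 + a * (b + D + 1 * (b * D)) := by gcongr
        _ = _ := by rw [one_mul]
  set D := (1 + b) ^ Fintype.card V - 1 with hD
  have hDt : D ≠ ∞ := ENNReal.sub_ne_top (ENNReal.pow_ne_top (by simp [hbt]))
  have hk : ∀ k, ∫⁻ y, S.failOddsFrom ε y c k ∂S.feedbackLaw ≤ r ^ k * D := by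
    intro k
    have hm : ∀ v, Measurable fun y => 1 + ∑' n, if k ≤ n then S.underOdds ε y c v n else 0 :=
      fun v => measurable_const.add (S.measurable_tsum_underOdds ε c v k)
    have h1 : ∀ v, ∫⁻ y, (1 + ∑' n, if k ≤ n then S.underOdds ε y c v n else 0) ∂S.feedbackLaw ≤
        1 + r ^ k * b := by
      intro v
      rw [lintegral_add_left measurable_const, lintegral_one, measure_univ, lintegral_tsum
        fun n => (by split_ifs <;> fun_prop)]
      gcongr
      calc ∑' n, ∫⁻ y, (if k ≤ n then S.underOdds ε y c v n else 0) ∂S.feedbackLaw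
          ≤ ∑' n, K * (if k ≤ n then r ^ n else 0) := by
            refine ENNReal.tsum_le_tsum fun n => ?_
            split_ifs
            · exact hK v n
            · simp
        _ = r ^ k * b := by
            rw [ENNReal.tsum_mul_left, tsum_ite_le_pow, hb]; ring
    have h2 : ∫⁻ y, ∏ v, (1 + ∑' n, if k ≤ n then S.underOdds ε y c v n else 0) ∂S.feedbackLaw ≤
        1 + r ^ k * D := by
      -- Responses of different followers are independent.
      rw [feedbackLaw, lintegral_infinitePi_finset_prod _ Finset.univ hm
        (s := fun v => {p | p.2.1 = v})]
      · refine (Finset.prod_le_prod' fun v _ => h1 v).trans ?_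
        rw [Finset.prod_const, Finset.card_univ]
        exact hpow _ (pow_le_one₀ zero_le hr1.le) _
      · intro v y y' h
        simp only [S.underOdds_dependsOn ε c v _ h]
      · intro v w hvw
        exact Set.disjoint_left.2 fun p h h' => hvw (Eq.trans (Eq.symm h) h')
    unfold failOddsFrom
    rw [lintegral_sub measurable_const (by simp) (ae_of_all _ fun y =>
      Finset.one_le_prod' fun v _ => le_self_add), lintegral_one, measure_univ]
    exact tsub_le_iff_left.2 h2
  have hfin : (1 - r)⁻¹ * D ≠ ∞ := ENNReal.mul_ne_top hinv hDt
  refine ⟨((1 - r)⁻¹ * D).toNNReal, ?_⟩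
  rw [ENNReal.coe_toNNReal hfin, ← ENNReal.tsum_geometric, ← ENNReal.tsum_mul_right]
  exact ENNReal.tsum_le_tsum hk

end Setting

/-- Comparison with the integral of `exp (-x t)` over `[0, T]`; the term `t = 0` accounts for the 1.
-/
theorem sum_exp_le {x : ℝ} (hx : 0 < x) (T : ℕ) :
    ∑ t ∈ Finset.range T, Real.exp (-x) ^ t ≤ 1 + (1 - Real.exp (-(x * T))) / x := by
  have h : ∀ T : ℕ, ∑ t ∈ Finset.range (T + 1), Real.exp (-x) ^ t ≤
      1 + (1 - Real.exp (-(x * T))) / x := by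
    intro T
    induction T with
    | zero => simp
    | succ T ih =>
      rw [Finset.sum_range_succ]
      have h1 : Real.exp (-x) ^ (T + 1) = Real.exp (-(x * T)) * Real.exp (-x) := by
        rw [← Real.exp_nat_mul, ← Real.exp_add]; push_cast; ring_nf
      have h2 : Real.exp (-(x * (T + 1 : ℕ))) = Real.exp (-(x * T)) * Real.exp (-x) := by
        rw [← Real.exp_add]; push_cast; ring_nf
      rw [h2, h1]
      set E := Real.exp (-(x * T))
      have hE : 0 < E := Real.exp_pos _
      have h3 : x * Real.exp (-x) ≤ 1 - Real.exp (-x) := by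
        have h4 := mul_le_mul_of_nonneg_right (Real.add_one_le_exp x) (Real.exp_pos (-x)).le
        rw [← Real.exp_add, add_neg_cancel, Real.exp_zero] at h4
        linarith
      have h5 : E * Real.exp (-x) ≤ E * (1 - Real.exp (-x)) / x := by
        rw [le_div_iff₀ hx]; nlinarith
      have h6 : (1 - E * Real.exp (-x)) / x = (1 - E) / x + E * (1 - Real.exp (-x)) / x := by
        field_simp; ring
      linarith
  refine (Finset.sum_le_sum_of_subset_of_nonneg (Finset.range_subset_range.2 T.le_succ)
    fun t _ _ => by positivity).trans (h T)

/-! ### Assembling the regret bound -/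

namespace Setting

variable {C V : Type*} [Fintype V] [Fintype C] (S : Setting C V)

/-- One margin serves all suboptimal topics; `ε ≤ 1` keeps the decay base `1 - 4 ε² / 9` positive,
so that its logarithm can be taken. -/
theorem exists_gap : ∃ ε : ℝ, 0 < ε ∧ ε ≤ 1 ∧
    ∀ c ∈ S.suboptimal, S.score S.trueQ c + ε < S.score S.trueQ (S.argmax S.trueQ) - ε := by
  have h : ∀ᶠ ε : ℝ in nhdsWithin 0 (Set.Ioi 0), ∀ c ∈ S.suboptimal,
      S.score S.trueQ c + ε < S.score S.trueQ (S.argmax S.trueQ) - ε := by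
    refine (Filter.eventually_all_finset _).2 fun c hc => ?_
    have hc := S.mem_suboptimal.1 hc
    filter_upwards [Ioo_mem_nhdsGT (show (0 : ℝ) <
      (S.score S.trueQ (S.argmax S.trueQ) - S.score S.trueQ c) / 2 by linarith)] with ε hε
    linarith [hε.2]
  obtain ⟨ε, h1, h2⟩ := (h.and (Ioo_mem_nhdsGT one_pos)).exists
  exact ⟨ε, h2.1, h2.2.le, h1⟩

variable (μ : C → V → ℝ≥0)

/-- The three summands belong to early posts, overestimates of `c` and underestimates of `c₀`; `L`
is still free. -/
theorem sum_law_topic_le {ε ρ : ℝ} {K B : ℝ≥0} (hε : 0 < ε) (hρ : 0 ≤ ρ) {c c₀ : C}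
    (hgap : S.score S.trueQ c + ε < S.score S.trueQ c₀ - ε)
    (hK : ∀ v n, ∫⁻ y, S.overProb ε y c v n ∂S.feedbackLaw ≤ K * ENNReal.ofReal ρ ^ n)
    (hB : ∑' k, ∫⁻ y, S.failOddsFrom ε y c₀ k ∂S.feedbackLaw ≤ B) (L T : ℕ) :
    ∑ t ∈ Finset.range T, S.law μ {ω | topic S.thompson ω t = c} ≤
      L + ∑ t ∈ Finset.range T, ∑ v, K * (ENNReal.ofReal ρ ^ L * (1 - ENNReal.ofReal ρ)⁻¹ *
        ENNReal.ofReal (Real.exp (-(μ c v * (1 - ρ)))) ^ t) + B := by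
  have hr := S.measurableRule_thompson
  have hsub : ∀ t, S.law μ {ω | topic S.thompson ω t = c} ≤
      S.law μ {ω | topic S.thompson ω t = c ∧ plays S.thompson ω c t < L} +
      ∑ v, S.law μ {ω | L ≤ plays S.thompson ω c t ∧
        S.q c v + ε < estimate S.thompson ω t c v} +
      S.law μ {ω | topic S.thompson ω t = c ∧
        S.score (estimate S.thompson ω t) c ≤ S.score S.trueQ c + ε} := by
    intro t
    have h : {ω : Sample C V | topic S.thompson ω t = c} ⊆
        ({ω | topic S.thompson ω t = c ∧ plays S.thompson ω c t < L} ∪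
        ⋃ v, {ω | L ≤ plays S.thompson ω c t ∧ S.q c v + ε < estimate S.thompson ω t c v}) ∪
        {ω | topic S.thompson ω t = c ∧
          S.score (estimate S.thompson ω t) c ≤ S.score S.trueQ c + ε} := by
      intro ω hω
      by_contra hn
      simp only [Set.mem_union, Set.mem_iUnion, Set.mem_ofPred_eq, not_or, not_and, not_exists,
        not_lt] at hn hω
      exact hn.2 hω (S.score_le_add hε.le fun v => hn.1.2 v (hn.1.1 hω))
    refine (measure_mono h).trans ((measure_union_le _ _).trans ?_)
    gcongr
    refine (measure_union_le _ _).trans ?_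
    gcongr
    exact measure_iUnion_fintype_le _ _
  refine (Finset.sum_le_sum fun t _ => hsub t).trans ?_
  rw [Finset.sum_add_distrib, Finset.sum_add_distrib]
  gcongr with t _ v _
  · exact sum_law_topic_plays_lt S μ hr c L T
  · exact (S.law_estimate_le μ hr ε c v L t).trans
      (S.lintegral_tsum_overProb_le μ hρ (hK v) L t)
  · exact (S.sum_law_topic_score_le μ hε hgap T).trans hB

omit [Fintype C] [Fintype V] in
theorem rate_arg_nonneg {θ : ℝ} (hθ : 0 < θ) (hμ : ∀ c v, 0 < μ c v) (c : C) (T : ℕ) (v : V) :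
    0 ≤ (1 - Real.exp (-((μ c v : ℝ) * θ * (T : ℝ)))) / ((μ c v : ℝ) * θ) := by
  have h : 0 < (μ c v : ℝ) := hμ c v
  refine div_nonneg (sub_nonneg.2 (Real.exp_le_one_iff.2 ?_)) (by positivity)
  have : 0 ≤ (μ c v : ℝ) * θ * T := by positivity
  linarith

omit [Fintype C] in
theorem rate_nonneg {θ : ℝ} (hθ : 0 < θ) (hμ : ∀ c v, 0 < μ c v) (c : C) (T : ℕ) :
    0 ≤ rate μ θ c T :=
  Real.log_nonneg (le_add_of_nonneg_right
    (Finset.sum_nonneg fun v _ => rate_arg_nonneg μ hθ hμ c T v))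

theorem sum_law_real_topic_le {ε d : ℝ} {K B : ℝ≥0} (hε : 0 < ε) (hd : 0 < d) {c c₀ : C}
    (hgap : S.score S.trueQ c + ε < S.score S.trueQ c₀ - ε)
    (hK : ∀ v n, ∫⁻ y, S.overProb ε y c v n ∂S.feedbackLaw ≤
      K * ENNReal.ofReal (Real.exp (-d)) ^ n)
    (hB : ∑' k, ∫⁻ y, S.failOddsFrom ε y c₀ k ∂S.feedbackLaw ≤ B)
    (hμ : ∀ c v, 0 < μ c v) (T : ℕ) :
    ∑ t ∈ Finset.range T, (S.law μ).real {ω | topic S.thompson ω t = c} ≤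
      (1 / d + 1 + K * (1 - Real.exp (-d))⁻¹ * (Fintype.card V + 1) + B) *
        (1 + rate μ (1 - Real.exp (-d)) c T) := by
  set ρ := Real.exp (-d) with hρ
  have hρ0 : 0 < ρ := Real.exp_pos _
  have hρ1 : ρ < 1 := Real.exp_lt_one_iff.2 (by linarith)
  set θ := 1 - ρ with hθ
  have hθ0 : 0 < θ := sub_pos.2 hρ1
  set A := ∑ v, (1 - Real.exp (-((μ c v : ℝ) * θ * (T : ℝ)))) / ((μ c v : ℝ) * θ) with hA
  have hA0 : 0 ≤ A := Finset.sum_nonneg fun v _ => rate_arg_nonneg μ hθ0 hμ c T v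
  have hrate : rate μ θ c T = Real.log (1 + A) := rfl
  have hl0 : 0 ≤ Real.log (1 + A) := Real.log_nonneg (by linarith)
  -- The least integer with `ρ ^ L ≤ (1 + A)⁻¹`: it offsets the sum over rounds, which is at most
  -- `Fintype.card V + A`, at the price of a logarithm.
  set L := ⌈Real.log (1 + A) / d⌉₊ with hL
  have hL1 : (L : ℝ) ≤ Real.log (1 + A) / d + 1 := (Nat.ceil_lt_add_one (by positivity)).le
  have hL2 : ρ ^ L ≤ (1 + A)⁻¹ := by
    rw [hρ, ← Real.exp_nat_mul, ← Real.exp_log (show 0 < (1 + A)⁻¹ by positivity), Real.exp_le_exp,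
      Real.log_inv]
    have := Nat.le_ceil (Real.log (1 + A) / d)
    rw [div_le_iff₀ hd] at this
    linarith
  have h := S.sum_law_topic_le μ hε hρ0.le hgap hK hB L T
  have hreal : ∑ t ∈ Finset.range T, (S.law μ).real {ω | topic S.thompson ω t = c} ≤
      L + ∑ t ∈ Finset.range T, ∑ v, K * (ρ ^ L * θ⁻¹ * Real.exp (-(μ c v * θ)) ^ t) + B := by
    have e1 : ∀ t v, (K : ℝ≥0∞) * (ENNReal.ofReal ρ ^ L * (1 - ENNReal.ofReal ρ)⁻¹ *
        ENNReal.ofReal (Real.exp (-(μ c v * (1 - ρ)))) ^ t) =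
        ENNReal.ofReal (K * (ρ ^ L * θ⁻¹ * Real.exp (-(μ c v * θ)) ^ t)) := by
      intro t v
      rw [ENNReal.ofReal_mul (by positivity), ENNReal.ofReal_mul (by positivity),
        ENNReal.ofReal_mul (by positivity), ENNReal.ofReal_pow hρ0.le,
        ENNReal.ofReal_pow (Real.exp_pos _).le, ENNReal.ofReal_inv_of_pos hθ0, hθ,
        ENNReal.ofReal_sub _ hρ0.le, ENNReal.ofReal_one, ENNReal.ofReal_coe_nnreal]
    simp_rw [e1] at h
    have hn : ∀ t v, 0 ≤ K * (ρ ^ L * θ⁻¹ * Real.exp (-(μ c v * θ)) ^ t) := fun t v => by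
      positivity
    simp_rw [← fun t => ENNReal.ofReal_sum_of_nonneg (s := Finset.univ) fun v _ => hn t v] at h
    rw [← ENNReal.ofReal_sum_of_nonneg fun t _ => Finset.sum_nonneg fun v _ => hn t v,
      ← ENNReal.ofReal_natCast, ← ENNReal.ofReal_coe_nnreal (p := B),
      ← ENNReal.ofReal_add (by positivity)
        (Finset.sum_nonneg fun t _ => Finset.sum_nonneg fun v _ => hn t v),
      ← ENNReal.ofReal_add (add_nonneg (by positivity)
        (Finset.sum_nonneg fun t _ => Finset.sum_nonneg fun v _ => hn t v)) (by positivity)] at h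
    have h' := ENNReal.toReal_mono ENNReal.ofReal_ne_top h
    rw [ENNReal.toReal_ofReal (add_nonneg (add_nonneg (by positivity)
        (Finset.sum_nonneg fun t _ => Finset.sum_nonneg fun v _ => hn t v)) (by positivity)),
      ENNReal.toReal_sum fun t _ => measure_ne_top _ _] at h'
    exact h'
  have hsum : ∑ t ∈ Finset.range T, ∑ v, K * (ρ ^ L * θ⁻¹ * Real.exp (-(μ c v * θ)) ^ t) ≤
      K * θ⁻¹ * (Fintype.card V + 1) := by
    have h1 : ∑ t ∈ Finset.range T, ∑ v, Real.exp (-(μ c v * θ)) ^ t ≤ Fintype.card V + A := by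
      rw [Finset.sum_comm]
      refine (Finset.sum_le_sum fun v _ => sum_exp_le
        (mul_pos (NNReal.coe_pos.2 (hμ c v)) hθ0) T).trans ?_
      rw [Finset.sum_add_distrib]
      simp [hA]
    have h2 : ∑ t ∈ Finset.range T, ∑ v, K * (ρ ^ L * θ⁻¹ * Real.exp (-(μ c v * θ)) ^ t) =
        K * θ⁻¹ * (ρ ^ L * ∑ t ∈ Finset.range T, ∑ v, Real.exp (-(μ c v * θ)) ^ t) := by
      simp_rw [Finset.mul_sum]
      refine Finset.sum_congr rfl fun t _ => Finset.sum_congr rfl fun v _ => by ring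
    rw [h2]
    gcongr
    calc ρ ^ L * ∑ t ∈ Finset.range T, ∑ v, Real.exp (-(μ c v * θ)) ^ t
        ≤ (1 + A)⁻¹ * (Fintype.card V + A) := by gcongr
      _ ≤ Fintype.card V + 1 := by
          rw [inv_mul_le_iff₀ (by positivity)]
          have : 0 ≤ A * Fintype.card V := by positivity
          nlinarith
  rw [hrate]
  have h3 : Real.log (1 + A) / d = 1 / d * Real.log (1 + A) := by ring
  have h4 : 0 ≤ K * θ⁻¹ * (Fintype.card V + 1 : ℝ) := by positivity
  have h5 : 0 ≤ 1 / d := by positivity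
  have h6 : (0 : ℝ) ≤ B := B.2
  have := mul_nonneg h4 hl0
  have := mul_nonneg h6 hl0
  nlinarith

theorem exists_abs_regret_le : ∃ d > (0 : ℝ), ∃ K ≥ (0 : ℝ), ∀ μ : C → V → ℝ≥0,
    (∀ c v, 0 < μ c v) → ∀ T : ℕ, |S.regret μ T| ≤
      K * ∑ c ∈ S.suboptimal, (1 + rate μ (1 - Real.exp (-d)) c T) := by
  obtain ⟨ε, hε, hε1, hgap⟩ := S.exists_gap
  -- The decay base of the concentration bounds; `d = -log ρ` depends only on the margin.
  set ρ := 1 - 4 * (ε ^ 2 / 9) with hρ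
  have hε2 : 0 < ε ^ 2 := by positivity
  have hρ0 : 0 < ρ := by nlinarith
  have hρ1 : ρ < 1 := by linarith
  obtain ⟨K, hK⟩ := S.exists_lintegral_le hε
  obtain ⟨B, hB⟩ := S.exists_tsum_lintegral_failOddsFrom_le hρ1 (S.argmax S.trueQ)
    fun v n => (hK (S.argmax S.trueQ) v n).2
  have hd : Real.exp (-(-Real.log ρ)) = ρ := by rw [neg_neg, Real.exp_log hρ0]
  have hd0 : 0 < -Real.log ρ := neg_pos.2 (Real.log_neg hρ0 hρ1)
  have hθ : 0 < 1 - Real.exp (-(-Real.log ρ)) := by rw [hd]; linarith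
  refine ⟨-Real.log ρ, hd0, 1 / (-Real.log ρ) + 1 +
    K * (1 - Real.exp (-(-Real.log ρ)))⁻¹ * (Fintype.card V + 1) + B, by positivity,
    fun μ hμ T => (S.abs_regret_le μ T).trans ?_⟩
  rw [Finset.sum_comm, Finset.mul_sum]
  refine Finset.sum_le_sum fun c hc => S.sum_law_real_topic_le μ hε hd0 (hgap c hc) ?_ hB hμ T
  intro v n
  rw [hd]
  exact (hK c v n).1

omit [Fintype C] in
theorem rate_le_of_forall {θ : ℝ} (hθ : 0 < θ) (hμ : ∀ c v, 0 < μ c v) (c : C) (T : ℕ) :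
    rate μ θ c T ≤ Real.log (1 + ∑ v, 1 / ((μ c v : ℝ) * θ)) := by
  have h0 := Finset.sum_nonneg (s := Finset.univ) fun v _ => rate_arg_nonneg μ hθ hμ c T v
  refine Real.log_le_log (by linarith) ?_
  gcongr with v
  linarith [Real.exp_pos (-((μ c v : ℝ) * θ * (T : ℝ)))]

omit [Fintype C] in
theorem rate_pos [Nonempty V] {θ : ℝ} (hθ : 0 < θ) (hμ : ∀ c v, 0 < μ c v) (c : C) :
    0 < rate μ θ c 1 := by
  refine Real.log_pos (lt_add_of_pos_right _ (Finset.sum_pos (fun v _ => ?_)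
    Finset.univ_nonempty))
  have : 0 < (μ c v : ℝ) := hμ c v
  refine div_pos (sub_pos.2 (Real.exp_lt_one_iff.2 ?_)) (by positivity)
  simp only [Nat.cast_one, mul_one, Left.neg_neg_iff]
  positivity

omit [Fintype C] in
theorem rate_mono {θ : ℝ} (hθ : 0 < θ) (hμ : ∀ c v, 0 < μ c v) (c : C) {T T' : ℕ} (h : T ≤ T') :
    rate μ θ c T ≤ rate μ θ c T' := by
  have h0 := Finset.sum_nonneg (s := Finset.univ) fun v _ => rate_arg_nonneg μ hθ hμ c T v
  refine Real.log_le_log (by linarith) ?_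
  gcongr

theorem regret_zero : S.regret μ 0 = 0 := by simp [regret, utility]

/-- Without followers the rate is `log 1 = 0`, so the bound in (2) requires the regret to vanish. It
does, because the score does not involve the draws. -/
theorem regret_of_isEmpty [IsEmpty V] (T : ℕ) : S.regret μ T = 0 := by
  have h : S.thompson = S.optimal := by
    funext n m b
    rw [thompson, optimal]
    congr 1
    funext c v
    exact isEmptyElim v
  rw [regret, h, sub_self]

end Setting

end Posting

theorem theorem3 {C V : Type*} [Fintype C] [Fintype V] (S : Posting.Setting C V) :
    ∃ d > (0 : ℝ), ∃ K : ℝ, ∀ μ : C → V → ℝ≥0, (∀ c v, 0 < μ c v) →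
      (∀ T : ℕ, |S.regret μ T| ≤
        K * ∑ c ∈ S.suboptimal, (1 + Posting.rate μ (1 - Real.exp (-d)) c T)) ∧
      (∀ c : C, ∃ K' : ℝ, ∀ T : ℕ, |S.regret μ T| ≤
        K' * Posting.rate μ (1 - Real.exp (-d)) c T) ∧
      (∃ B : ℝ, ∀ T : ℕ, |S.regret μ T| ≤ B) := by
  obtain ⟨d, hd, K, hK, h⟩ := S.exists_abs_regret_le
  have hθ : 0 < 1 - Real.exp (-d) := sub_pos.2 (Real.exp_lt_one_iff.2 (by linarith))
  refine ⟨d, hd, K, fun μ hμ => ?_⟩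
  have hbdd : ∃ B : ℝ, ∀ T : ℕ, |S.regret μ T| ≤ B :=
    ⟨K * ∑ c ∈ S.suboptimal, (1 + Real.log (1 + ∑ v, 1 / ((μ c v : ℝ) * (1 - Real.exp (-d))))),
      fun T => (h μ hμ T).trans (mul_le_mul_of_nonneg_left (Finset.sum_le_sum fun c _ => by
        linarith [Posting.Setting.rate_le_of_forall μ hθ hμ c T]) hK)⟩
  refine ⟨h μ hμ, fun c => ?_, hbdd⟩
  obtain ⟨B, hB⟩ := hbdd
  cases isEmpty_or_nonempty V with
  | inl hV => exact ⟨0, fun T => by rw [S.regret_of_isEmpty μ T]; simp⟩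
  | inr hV =>
    have hpos := Posting.Setting.rate_pos μ hθ hμ c
    -- For `T ≥ 1` the rate is at least its positive value at 1, so a bounded regret is a multiple
    -- of it; at `T = 0` the regret is zero.
    refine ⟨B / Posting.rate μ (1 - Real.exp (-d)) c 1, fun T => ?_⟩
    have hB0 : 0 ≤ B := (abs_nonneg _).trans (hB 0)
    rcases Nat.eq_zero_or_pos T with rfl | hT
    · rw [S.regret_zero, abs_zero]
      exact mul_nonneg (by positivity) (Posting.Setting.rate_nonneg μ hθ hμ c 0)
    · calc |S.regret μ T| ≤ B := hB T
        _ = B / Posting.rate μ (1 - Real.exp (-d)) c 1 *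
            Posting.rate μ (1 - Real.exp (-d)) c 1 := by field_simp
        _ ≤ _ := mul_le_mul_of_nonneg_left (Posting.Setting.rate_mono μ hθ hμ c hT) (by positivity)
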